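/- Let $d\ge 2$ and let $G$ be a probability measure on $\mathbb{R}$ for which there are $0<a<b$ and $\alpha>0$ such that $G$ is supported on $[a,b]$ and is absolutely continuous with a density $\rho$ satisfying $\rho(x)\ge\alpha$ for almost every $x\in[a,b]$. Consider first-passage percolation on $\mathbb{Z}^d$: the nearest-neighbour edges $e$ carry i.i.d. weights $t_e$ with law $G$, a finite path $p$ has passage time $T(p)=\sum_{e\in p}t_e$, and $\gamma(0,v)$ denotes the almost surely unique geodesic from $0$ to $v$, that is, the path from $0$ to $v$ of minimal passage time. Let $\|\cdot\|$ and $(\cdot,\cdot)$ be the Euclidean norm and inner product on $\mathbb{R}^d$, and for $u\in\mathbb{R}^d$ and $r>0$ let $\mathrm{cyl}(0,u,r)=\{w\in\mathbb{R}^d:\ \|w-\lambda u\|\le r\text{ for some }\lambda\in\mathbb{R}\}$. Then there exist $c>0$ and $n_0\ge 1$, depending only on $d$ and $G$, such that for all $v\in\mathbb{Z}^d$ with $\|v\|\ge n_0$ and all real $\ell$ with $(\log\|v\|)^{d+2}\le\ell\le\|v\|$, $$\mathbb{E}\Big(\big|\{u\in\gamma(0,v):\ 0\le(u,\hat v)\le\ell\}\setminus\mathrm{cyl}\big(0,v,c\,\ell^{\frac1{d+1}}\big)\big|\Big)\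 \ge\ \frac{\ell}{2},\qquad \hat v:=\frac{v}{\|v\|},$$ where $u$ ranges over the vertices of $\gamma(0,v)$. In particular, for all $v\in\mathbb{Z}^d$ with $\|v\|\ge n_0$, the expected number of vertices of $\gamma(0,v)$ outside $\mathrm{cyl}\big(0,v,c\|v\|^{\frac1{d+1}}\big)$ is at least $\|v\|/2$. -/

import Mathlib

open MeasureTheory ProbabilityTheory

namespace FPP

/-- The hypercubic lattice `ℤ^d` with nearest-neighbour edges. -/
def lattice (d : ℕ) : SimpleGraph (Fin d → ℤ) where
  Adj x y := ∑ i, |x i - y i| = 1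
  symm := ⟨fun x y h => by simpa only [abs_sub_comm] using h⟩
  loopless := ⟨fun x h => by simp at h⟩

/-- The edge set `E(ℤ^d)`. -/
abbrev Edge (d : ℕ) : Type := (lattice d).edgeSet

/-- The passage time `T(p) = ∑_{e ∈ p} t_e` of a finite path in the environment `t`. -/
def passageTime {d : ℕ} (t : Edge d → ℝ) {x y : Fin d → ℤ} (p : (lattice d).Walk x y) : ℝ :=
  (p.darts.map fun a => t ⟨a.edge, a.edge_mem⟩).sum

/-- A geodesic: a path from `x` to `y` achieving the minimal passage time among all finite
paths from `x` to `y`. -/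
def IsGeodesic {d : ℕ} (t : Edge d → ℝ) {x y : Fin d → ℤ} (p : (lattice d).Walk x y) : Prop :=
  ∀ q : (lattice d).Walk x y, passageTime t p ≤ passageTime t q

/-- The vertices of the geodesic `γ(x, y)`: the vertices of the unique geodesic from `x` to `y`
(the empty set in environments where there is no geodesic or more than one). -/
def geodesicVertices {d : ℕ} (t : Edge d → ℝ) (x y : Fin d → ℤ) : Set (Fin d → ℤ) :=
  {u | ∃ p : (lattice d).Walk x y,
    IsGeodesic t p ∧ (∀ q : (lattice d).Walk x y, IsGeodesic t q → q = p) ∧ u ∈ p.support}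

/-- A lattice point, seen in `ℝ^d` with the `ℓ²` norm. -/
def toEuclid {d : ℕ} (x : Fin d → ℤ) : EuclideanSpace ℝ (Fin d) :=
  WithLp.toLp 2 fun i => (x i : ℝ)

/-- `cyl(0, u, r)`: the infinite cylinder of radius `r` around the line through `0` and `u`. -/
def cyl {d : ℕ} (u : EuclideanSpace ℝ (Fin d)) (r : ℝ) : Set (EuclideanSpace ℝ (Fin d)) :=
  {w | ∃ s : ℝ, ‖w - s • u‖ ≤ r}

/-- The assumption on the weight distribution: for some `0 < a < b` and `α > 0`, `G` is supported
on `[a, b]` and has a Lebesgue density `ρ` with `ρ ≥ α` almost everywhere on `[a, b]`. -/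
def WeightAssumption (G : Measure ℝ) : Prop :=
  ∃ a b α : ℝ, 0 < a ∧ a < b ∧ 0 < α ∧ G (Set.Icc a b)ᶜ = 0 ∧
    ∃ ρ : ℝ → ENNReal, Measurable ρ ∧ G = volume.withDensity ρ ∧
      ∀ᵐ x ∂(volume.restrict (Set.Icc a b)), ENNReal.ofReal α ≤ ρ x

end FPP

namespace FPP

/-! The argument is by contradiction. Suppose that in the slab `0 ≤ height ≤ ℓ` the geodesic
`γ(0,v)` has fewer than `ℓ/2` expected vertices outside the cylinder of radius `r`. Markov's
inequality and the fact that a geodesic crossing the slab meets every unit layer show that, with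
probability at least `1/3`, it has of order `ℓ` vertices inside the cylinder. Now shift the cylinder
by `m` multiples of about `3r` along a coordinate direction transversal to `v`. The shifted regions
are disjoint and lie outside the original cylinder, so one of them receives at most `ℓ/(2m)`
expected vertices. By translation invariance, some `γ(w, v+w)` with `w` of order `m r` rarely visits
the original region `S` (`exists_translate_integral_le`).

The weights on the edges touching `S` are then perturbed. Their density is multiplied by `1 ∓ τ`
below/above the median, and a monotone map `φ` brings the tilted law back to `G`
(`exists_isTilting`). There are `O(ℓ r^(d-1))` such edges, so for `τ² ≈ 1/(ℓ r^(d-1))` the tilted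
law of the configuration stays close to the i.i.d. law (`IsTilting.measureReal_le`). Under the
tilted law one obtains, with positive probability, a configuration `x` in which `γ(0,v)` has many
vertices in `S`, while in `t = φ(x) ≤ x` the geodesic `γ(w,v+w)` has few.

Passing from `t` to `x` raises the cost of the first geodesic by at least `κτ` on most of its edges
near `S`, and that of the second by at most `τ/α` per edge touching `S`. Moving between the two
pairs of endpoints costs `O(m r)`, so the gain cannot exceed the loss plus this amount
(`gain_le_of_isGeodesic`). For `m` large this forces `τ ℓ ≤ C r`, that is `ℓ ≤ C r^(d+1)`, which
fails for `r = c ℓ^(1/(d+1))` with `c` small.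

The density need not be bounded above, so some weights may move by much less than `τ`. They are
handled by choosing a set of robust weights of `G`-measure close to one and a union bound over
lattice paths (`exists_robustWeights`, `exists_few_exceptional`). -/

variable {d : ℕ}

/-! ### Walks, their enumeration, and existence of geodesics. -/

/-- The list of edges of a walk. -/
def edgeList {x y : Fin d → ℤ} (p : (lattice d).Walk x y) : List (Edge d) :=
  p.darts.map fun a => ⟨a.edge, a.edge_mem⟩

theorem passageTime_eq_sum_edgeList (t : Edge d → ℝ) {x y : Fin d → ℤ}
    (p : (lattice d).Walk x y) : passageTime t p = ((edgeList p).map t).sum := by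
  simp [passageTime, edgeList, Function.comp_def]

theorem edgeList_map_val {x y : Fin d → ℤ} (p : (lattice d).Walk x y) :
    (edgeList p).map Subtype.val = p.edges := by
  simp [edgeList, Function.comp_def, SimpleGraph.Walk.edges]

theorem mem_edgeList {x y : Fin d → ℤ} {p : (lattice d).Walk x y} {e : Edge d} :
    e ∈ edgeList p ↔ (e : Sym2 (Fin d → ℤ)) ∈ p.edges := by
  rw [← edgeList_map_val]
  simp

@[simp]
theorem length_edgeList {x y : Fin d → ℤ} (p : (lattice d).Walk x y) :
    (edgeList p).length = p.length := by
  simp [edgeList]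

theorem edgeList_injective {x y : Fin d → ℤ} :
    Function.Injective (edgeList : (lattice d).Walk x y → List (Edge d)) := by
  intro p q h
  apply SimpleGraph.Walk.edges_injective
  rw [← edgeList_map_val, ← edgeList_map_val, h]

theorem nodup_edgeList {x y : Fin d → ℤ} {p : (lattice d).Walk x y} (hp : p.IsPath) :
    (edgeList p).Nodup := by
  apply List.Nodup.of_map Subtype.val
  rw [edgeList_map_val]
  exact hp.isTrail.edges_nodup

theorem passageTime_append (t : Edge d → ℝ) {x y z : Fin d → ℤ} (p : (lattice d).Walk x y)
    (q : (lattice d).Walk y z) :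
    passageTime t (p.append q) = passageTime t p + passageTime t q := by
  simp [passageTime]

theorem le_passageTime {t : Edge d → ℝ} {a : ℝ} (ht : ∀ e, a ≤ t e) {x y : Fin d → ℤ}
    (p : (lattice d).Walk x y) : a * p.length ≤ passageTime t p := by
  rw [passageTime_eq_sum_edgeList]
  have := List.card_nsmul_le_sum ((edgeList p).map t) a (by
    simp only [List.mem_map]
    rintro _ ⟨e, -, rfl⟩
    exact ht e)
  simpa [mul_comm] using this

theorem passageTime_le {t : Edge d → ℝ} {b : ℝ} (ht : ∀ e, t e ≤ b) {x y : Fin d → ℤ}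
    (p : (lattice d).Walk x y) : passageTime t p ≤ b * p.length := by
  rw [passageTime_eq_sum_edgeList]
  have := List.sum_le_card_nsmul ((edgeList p).map t) b (by
    simp only [List.mem_map]
    rintro _ ⟨e, -, rfl⟩
    exact ht e)
  simpa [mul_comm] using this

theorem exists_walk_length_le (x y : Fin d → ℤ) :
    ∃ p : (lattice d).Walk x y, (p.length : ℤ) ≤ ∑ i, |x i - y i| := by
  obtain ⟨n, hn⟩ : ∃ n : ℕ, ∑ i, |x i - y i| = n :=
    ⟨(∑ i, |x i - y i|).toNat, (Int.toNat_of_nonneg (Finset.sum_nonneg fun _ _ => abs_nonneg _)).symm⟩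
  induction n generalizing x with
  | zero =>
    have h : x = y := by
      ext i
      have := (Finset.sum_eq_zero_iff_of_nonneg (fun i _ => abs_nonneg (x i - y i))).1 hn i
        (Finset.mem_univ _)
      rwa [abs_eq_zero, sub_eq_zero] at this
    subst h
    exact ⟨.nil, by simp⟩
  | succ n ih =>
    obtain ⟨i, hi⟩ : ∃ i, x i ≠ y i := by
      by_contra! h
      simp [h] at hn
      lia
    let x' := Function.update x i (x i + SignType.sign (y i - x i))
    have hs : ∀ z : ℤ, z ≠ 0 → |(SignType.sign z : ℤ)| = 1 := by
      intro z hz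
      rcases lt_or_gt_of_ne hz with h | h <;> simp [h]
    have hadj : (lattice d).Adj x x' := by
      change ∑ j, |x j - x' j| = 1
      rw [Finset.sum_eq_single i]
      · simp only [x', Function.update_self]
        rw [sub_add_cancel_left, abs_neg, hs _ (sub_ne_zero.2 hi.symm)]
      · intro j _ hj
        simp [x', hj]
      · simp
    have hd : ∑ j, |x' j - y j| = n := by
      have h1 : ∑ j, |x j - y j| - ∑ j, |x' j - y j| = 1 := by
        rw [← Finset.sum_sub_distrib, Finset.sum_eq_single i]
        · simp only [x', Function.update_self]
          rcases lt_or_gt_of_ne hi with h | h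
          · rw [sign_pos (sub_pos.2 h)]
            simp only [SignType.coe_one]
            rw [abs_of_neg (by lia), abs_of_nonpos (by lia)]
            ring
          · rw [sign_neg (sub_neg.2 h)]
            simp only [SignType.coe_neg_one]
            rw [abs_of_pos (by lia), abs_of_nonneg (by lia)]
            ring
        · intro j _ hj
          simp [x', hj]
        · simp
      push_cast at hn
      linarith
    obtain ⟨p, hp⟩ := ih x' hd
    refine ⟨.cons hadj p, ?_⟩
    rw [SimpleGraph.Walk.length_cons, hn]
    push_cast
    linarith

/-- A finite set of sites containing all the neighbours of `x`. -/
noncomputable def box (x : Fin d → ℤ) : Finset (Fin d → ℤ) :=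
  Fintype.piFinset fun i => Finset.Icc (x i - 1) (x i + 1)

theorem card_box (x : Fin d → ℤ) : (box x).card = 3 ^ d := by
  simp only [box, Fintype.card_piFinset, Int.card_Icc]
  have : ∀ i, (x i + 1 + 1 - (x i - 1)).toNat = 3 := fun i => by
    rw [show x i + 1 + 1 - (x i - 1) = 3 by ring]; rfl
  simp [this]

theorem mem_box_of_adj {x y : Fin d → ℤ} (h : (lattice d).Adj x y) : y ∈ box x := by
  simp only [box, Fintype.mem_piFinset, Finset.mem_Icc]
  intro i
  have h1 : |x i - y i| ≤ 1 := by
    have : ∑ i, |x i - y i| = 1 := h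
    rw [← this]
    exact Finset.single_le_sum (f := fun i => |x i - y i|) (fun _ _ => abs_nonneg _)
      (Finset.mem_univ i)
  rw [abs_le] at h1
  constructor <;> linarith

open Classical in
/-- The edge lists of the walks of length `n` started at `x`. -/
noncomputable def edgeLists : ℕ → (Fin d → ℤ) → Finset (List (Edge d))
  | 0, _ => {[]}
  | n + 1, x => (box x).biUnion fun y =>
      if h : (lattice d).Adj x y then (edgeLists n y).image (⟨s(x, y), h⟩ :: ·) else ∅

theorem card_edgeLists_le (n : ℕ) (x : Fin d → ℤ) : (edgeLists n x).card ≤ (3 ^ d) ^ n := by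
  induction n generalizing x with
  | zero => simp [edgeLists]
  | succ n ih =>
    rw [edgeLists, pow_succ', ← card_box x]
    refine Finset.card_biUnion_le_card_mul _ _ _ fun y _ => ?_
    split_ifs with h
    · rw [card_box]
      exact Finset.card_image_le.trans (ih y)
    · simp

theorem edgeList_mem_edgeLists {x y : Fin d → ℤ} (p : (lattice d).Walk x y) :
    edgeList p ∈ edgeLists p.length x := by
  induction p with
  | nil => simp [edgeList, edgeLists]
  | @cons u v w h p ih =>
    simp only [SimpleGraph.Walk.length_cons, edgeLists, Finset.mem_biUnion]
    refine ⟨v, mem_box_of_adj h, ?_⟩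
    rw [dif_pos h]
    exact Finset.mem_image.2 ⟨edgeList p, ih, by simp [edgeList, SimpleGraph.Dart.edge]⟩

instance countable_edge : Countable (Edge d) := Subtype.countable

instance countable_walk (x y : Fin d → ℤ) : Countable ((lattice d).Walk x y) :=
  edgeList_injective.countable

theorem finite_walk_length_le (x y : Fin d → ℤ) (n : ℕ) :
    {p : (lattice d).Walk x y | p.length ≤ n}.Finite := by
  classical
  refine Set.Finite.of_finite_image (f := edgeList) ?_ edgeList_injective.injOn
  refine ((Finset.range (n + 1)).biUnion fun k => edgeLists k x).finite_toSet.subset ?_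
  rintro _ ⟨p, hp, rfl⟩
  simp only [Finset.coe_biUnion, Set.mem_iUnion]
  exact ⟨p.length, by simpa [Nat.lt_succ_iff] using hp, edgeList_mem_edgeLists p⟩

/-- A walk with more than `T(p₀)/a` edges is no cheaper than `p₀`, so only finitely many walks
compete. -/
theorem exists_isGeodesic {t : Edge d → ℝ} {a : ℝ} (ha : 0 < a) (ht : ∀ e, a ≤ t e)
    (x y : Fin d → ℤ) : ∃ p : (lattice d).Walk x y, IsGeodesic t p := by
  obtain ⟨p₀, -⟩ := exists_walk_length_le x y
  obtain ⟨n, hn⟩ := exists_nat_ge (passageTime t p₀ / a)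
  rw [div_le_iff₀ ha] at hn
  have hlong : ∀ q : (lattice d).Walk x y, ¬ q.length ≤ n → passageTime t p₀ ≤ passageTime t q := by
    intro q hq
    refine hn.trans (le_trans ?_ (le_passageTime ht q))
    rw [mul_comm]
    gcongr
    exact (not_le.1 hq).le
  by_cases h0 : p₀.length ≤ n
  · obtain ⟨p, hp, hmin⟩ := Set.exists_min_image _ (passageTime t) (finite_walk_length_le x y n)
      ⟨p₀, h0⟩
    refine ⟨p, fun q => ?_⟩
    by_cases hq : q.length ≤ n
    · exact hmin q hq
    · exact (hmin p₀ h0).trans (hlong q hq)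
  · exfalso
    have h1 := le_passageTime ht p₀
    have h2 : (n : ℝ) < p₀.length := by exact_mod_cast not_le.1 h0
    nlinarith

/-- Loop erasure removes steps with `t - a ≥ 0`, so by minimality it cannot shorten the walk; a walk
of the same length as its loop erasure is that erasure. -/
theorem IsGeodesic.isPath {t : Edge d → ℝ} {a : ℝ} (ha : 0 < a) (ht : ∀ e, a ≤ t e)
    {x y : Fin d → ℤ} {p : (lattice d).Walk x y} (hp : IsGeodesic t p) : p.IsPath := by
  have h1 : passageTime t p.bypass - a * p.bypass.length ≤ passageTime t p - a * p.length := by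
    have hsub : ((p.bypass.darts.map fun e => t ⟨e.edge, e.edge_mem⟩ - a).sum : ℝ) ≤
        (p.darts.map fun e => t ⟨e.edge, e.edge_mem⟩ - a).sum := by
      apply List.Sublist.sum_le_sum
      · exact p.darts_bypass_sublist_darts.map _
      · intro z hz
        simp only [List.mem_map] at hz
        obtain ⟨e, -, rfl⟩ := hz
        linarith [ht ⟨e.edge, e.edge_mem⟩]
    have key : ∀ l : List (lattice d).Dart, (l.map fun e => t ⟨e.edge, e.edge_mem⟩ - a).sum =
        (l.map fun e => t ⟨e.edge, e.edge_mem⟩).sum - a * l.length := by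
      intro l
      induction l with
      | nil => simp
      | cons e l ih => simp [ih]; ring
    rw [key, key] at hsub
    simpa [passageTime] using hsub
  have h2 := hp p.bypass
  have h3 : (p.length : ℝ) ≤ p.bypass.length := by
    have : a * p.length ≤ a * p.bypass.length := by linarith
    exact le_of_mul_le_mul_left this ha
  rw [← SimpleGraph.Walk.bypass_eq_self_of_length_le_length_bypass (p := p) (by exact_mod_cast h3)]
  exact p.bypass_isPath

/-- A path has a single edge at its starting vertex, so the first steps agree and induction applies.
Hence two distinct paths are separated by an edge of one that is not in the other. -/
theorem eq_of_edges_subset {x y : Fin d → ℤ} {p q : (lattice d).Walk x y} (hp : p.IsPath)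
    (hq : q.IsPath) (h : ∀ e ∈ q.edges, e ∈ p.edges) : q = p := by
  induction q with
  | nil =>
    exact (SimpleGraph.Walk.eq_nil_iff_nil.2 (SimpleGraph.Walk.isPath_iff_nil.1 hp)).symm
  | @cons u v w huv q ih =>
    cases p with
    | nil => exact absurd (h s(u, v) (by simp)) (by simp)
    | @cons _ v' _ huv' p =>
      rw [SimpleGraph.Walk.cons_isPath_iff] at hp hq
      have hv : v = v' := by
        have := h s(u, v) (by simp)
        rw [SimpleGraph.Walk.edges_cons, List.mem_cons] at this
        rcases this with h1 | h1
        · simpa [huv.ne, huv'.ne] using h1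
        · exact absurd (p.fst_mem_support_of_mem_edges h1) hp.2
      subst hv
      rw [ih hp.1 hq.1]
      intro e he
      have := h e (by simp [he])
      rw [SimpleGraph.Walk.edges_cons, List.mem_cons] at this
      rcases this with rfl | h1
      · exact absurd (q.fst_mem_support_of_mem_edges he) hq.2
      · exact h1

/-! ### Unique geodesics and measurability of vertex counts. -/

/-- `p` is the unique geodesic between its endpoints. -/
def IsUniqueGeodesic (t : Edge d → ℝ) {x y : Fin d → ℤ} (p : (lattice d).Walk x y) : Prop :=
  IsGeodesic t p ∧ ∀ q : (lattice d).Walk x y, IsGeodesic t q → q = p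

theorem IsUniqueGeodesic.geodesicVertices_eq {t : Edge d → ℝ} {x y : Fin d → ℤ}
    {p : (lattice d).Walk x y} (hp : IsUniqueGeodesic t p) :
    geodesicVertices t x y = {u | u ∈ p.support} := by
  ext u
  constructor
  · rintro ⟨q, hq, -, hu⟩
    rwa [hp.2 q hq] at hu
  · exact fun hu => ⟨p, hp.1, hp.2, hu⟩

theorem geodesicVertices_eq_empty {t : Edge d → ℝ} {x y : Fin d → ℤ}
    (h : ∀ p : (lattice d).Walk x y, ¬ IsUniqueGeodesic t p) : geodesicVertices t x y = ∅ := by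
  ext u
  simp only [Set.mem_empty_iff_false, iff_false]
  rintro ⟨p, hp, hp', -⟩
  exact h p ⟨hp, hp'⟩

theorem finite_geodesicVertices (t : Edge d → ℝ) (x y : Fin d → ℤ) :
    (geodesicVertices t x y).Finite := by
  by_cases h : ∃ p : (lattice d).Walk x y, IsUniqueGeodesic t p
  · obtain ⟨p, hp⟩ := h
    rw [hp.geodesicVertices_eq]
    exact List.finite_toSet _
  · push Not at h
    rw [geodesicVertices_eq_empty h]
    exact Set.finite_empty

@[fun_prop]
theorem measurable_passageTime {x y : Fin d → ℤ} (p : (lattice d).Walk x y) :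
    Measurable fun t : Edge d → ℝ => passageTime t p := by
  simp only [passageTime_eq_sum_edgeList]
  induction edgeList p with
  | nil => simp
  | cons e l ih => simp only [List.map_cons, List.sum_cons]; fun_prop

theorem measurableSet_isUniqueGeodesic {x y : Fin d → ℤ} (p : (lattice d).Walk x y) :
    MeasurableSet {t : Edge d → ℝ | IsUniqueGeodesic t p} := by
  have h : ∀ q : (lattice d).Walk x y, MeasurableSet {t : Edge d → ℝ | IsGeodesic t q} := by
    intro q
    simp only [IsGeodesic, Set.ofPred_forall]
    exact MeasurableSet.iInter fun r =>
      measurableSet_le (measurable_passageTime q) (measurable_passageTime r)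
  simp only [IsUniqueGeodesic, Set.ofPred_and, Set.ofPred_forall]
  refine (h p).inter (MeasurableSet.iInter fun q => ?_)
  by_cases hq : q = p
  · simp [hq]
  · simp only [hq, imp_false]
    exact (h q).compl

/-- The number of vertices of the geodesic from `x` to `y` which belong to `S`. -/
noncomputable def geodesicCount (S : Set (Fin d → ℤ)) (x y : Fin d → ℤ) (t : Edge d → ℝ) : ℕ :=
  (geodesicVertices t x y ∩ S).ncard

theorem measurable_geodesicCount (S : Set (Fin d → ℤ)) (x y : Fin d → ℤ) :
    Measurable (geodesicCount S x y) := by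
  refine measurable_to_countable' fun k => ?_
  have : geodesicCount S x y ⁻¹' {k} =
      (⋃ p : (lattice d).Walk x y, {t | IsUniqueGeodesic t p} ∩
        {t | ({u | u ∈ p.support} ∩ S).ncard = k}) ∪
      ((⋂ p : (lattice d).Walk x y, {t | IsUniqueGeodesic t p}ᶜ) ∩ {t | k = 0}) := by
    ext t
    simp only [Set.mem_preimage, Set.mem_singleton_iff, Set.mem_union, Set.mem_iUnion,
      Set.mem_inter_iff, Set.mem_ofPred_eq, Set.mem_iInter, Set.mem_compl_iff]
    by_cases h : ∃ p : (lattice d).Walk x y, IsUniqueGeodesic t p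
    · obtain ⟨p, hp⟩ := h
      rw [geodesicCount, hp.geodesicVertices_eq]
      constructor
      · exact fun hk => Or.inl ⟨p, hp, hk⟩
      · rintro (⟨q, hq, hk⟩ | ⟨h, -⟩)
        · rwa [hp.2 q hq.1] at hk
        · exact absurd hp (h p)
    · push Not at h
      simp [geodesicCount, geodesicVertices_eq_empty h, h, eq_comm]
  rw [this]
  refine (MeasurableSet.iUnion fun p => ?_).union ((MeasurableSet.iInter fun p => ?_).inter ?_)
  · exact (measurableSet_isUniqueGeodesic p).inter (MeasurableSet.const _)
  · exact (measurableSet_isUniqueGeodesic p).compl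
  · exact MeasurableSet.const _

/-- An environment with weights in `[a, b]` in which distinct paths with the same endpoints have
different passage times. -/
structure IsRegular (a b : ℝ) (t : Edge d → ℝ) : Prop where
  le : ∀ e, a ≤ t e
  ge : ∀ e, t e ≤ b
  ne : ∀ (x y : Fin d → ℤ) (p q : (lattice d).Walk x y), p.IsPath → q.IsPath → p ≠ q →
    passageTime t p ≠ passageTime t q

theorem IsRegular.exists_isUniqueGeodesic {a b : ℝ} (ha : 0 < a) {t : Edge d → ℝ}
    (ht : IsRegular a b t) (x y : Fin d → ℤ) :
    ∃ p : (lattice d).Walk x y, IsUniqueGeodesic t p ∧ p.IsPath := by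
  obtain ⟨p, hp⟩ := exists_isGeodesic ha ht.le x y
  refine ⟨p, ⟨hp, fun q hq => ?_⟩, hp.isPath ha ht.le⟩
  by_contra hne
  exact ht.ne x y q p (hq.isPath ha ht.le) (hp.isPath ha ht.le) hne (le_antisymm (hq p) (hp q))

theorem IsGeodesic.passageTime_le {t : Edge d → ℝ} {b : ℝ} (hb : 0 ≤ b) (ht : ∀ e, t e ≤ b)
    {x y : Fin d → ℤ} {p : (lattice d).Walk x y} (hp : IsGeodesic t p) :
    passageTime t p ≤ b * ∑ i, |(x i : ℝ) - y i| := by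
  obtain ⟨q, hq⟩ := exists_walk_length_le x y
  have hq' : (q.length : ℝ) ≤ ∑ i, |(x i : ℝ) - y i| := by exact_mod_cast hq
  calc passageTime t p ≤ passageTime t q := hp q
    _ ≤ b * q.length := FPP.passageTime_le ht q
    _ ≤ _ := by gcongr

theorem geodesicCount_le {a b : ℝ} (ha : 0 < a) (hab : a ≤ b) {t : Edge d → ℝ}
    (ht : IsRegular a b t) (S : Set (Fin d → ℤ)) (x y : Fin d → ℤ) :
    (geodesicCount S x y t : ℝ) ≤ b / a * ∑ i, |(x i : ℝ) - y i| + 1 := by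
  classical
  obtain ⟨p, hp, hpath⟩ := ht.exists_isUniqueGeodesic ha x y
  have h1 : geodesicCount S x y t ≤ p.length + 1 := by
    rw [geodesicCount, hp.geodesicVertices_eq, ← SimpleGraph.Walk.length_support]
    refine (Set.ncard_le_ncard Set.inter_subset_left (List.finite_toSet _)).trans ?_
    have : {u | u ∈ p.support} = (p.support.toFinset : Set (Fin d → ℤ)) := by ext; simp
    rw [this, Set.ncard_coe_finset]
    exact p.support.toFinset_card_le
  have h2 := (le_passageTime ht.le p).trans (hp.1.passageTime_le (ha.le.trans hab) ht.ge)
  have h3 : (p.length : ℝ) ≤ b / a * ∑ i, |(x i : ℝ) - y i| := by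
    rw [div_mul_eq_mul_div, le_div_iff₀ ha]
    linarith
  have h4 : (geodesicCount S x y t : ℝ) ≤ p.length + 1 := by exact_mod_cast h1
  linarith

/-! ### The weight distribution and its distribution function. -/

/-- Quantitative form of the assumption on the weight distribution. -/
structure WeightBounds (G : Measure ℝ) (a b α : ℝ) : Prop where
  a_pos : 0 < a
  a_lt_b : a < b
  α_pos : 0 < α
  support : G (Set.Icc a b)ᶜ = 0
  absolutelyContinuous : G ≪ volume
  le_measure : ∀ x y, a ≤ x → y ≤ b → ENNReal.ofReal (α * (y - x)) ≤ G (Set.Ioc x y)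

theorem WeightAssumption.exists_weightBounds {G : Measure ℝ} (hG : WeightAssumption G) :
    ∃ a b α, WeightBounds G a b α := by
  obtain ⟨a, b, α, ha, hab, hα, hsupp, ρ, hρ, rfl, hle⟩ := hG
  refine ⟨a, b, α, ha, hab, hα, hsupp, withDensity_absolutelyContinuous _ _, fun x y hx hy => ?_⟩
  rw [withDensity_apply _ measurableSet_Ioc]
  have hsub : Set.Ioc x y ⊆ Set.Icc a b := fun z hz => ⟨hx.trans hz.1.le, hz.2.trans hy⟩
  calc ENNReal.ofReal (α * (y - x)) = ∫⁻ _ in Set.Ioc x y, ENNReal.ofReal α := by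
        rw [setLIntegral_const, Real.volume_Ioc, ENNReal.ofReal_mul hα.le]
    _ ≤ _ := lintegral_mono_ae (ae_restrict_of_ae_restrict_of_subset hsub hle)

theorem WeightBounds.measure_singleton {G : Measure ℝ} {a b α : ℝ} (hG : WeightBounds G a b α)
    (x : ℝ) : G {x} = 0 :=
  hG.absolutelyContinuous (MeasureTheory.measure_singleton x)

namespace WeightBounds

variable {G : Measure ℝ} [IsProbabilityMeasure G] {a b α : ℝ}

theorem measure_Ioc (G : Measure ℝ) [IsProbabilityMeasure G] (x y : ℝ) :
    G (Set.Ioc x y) = ENNReal.ofReal (cdf G y - cdf G x) := by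
  conv_lhs => rw [← measure_cdf G]
  exact StieltjesFunction.measure_Ioc _ _ _

theorem continuous_cdf (hG : WeightBounds G a b α) : Continuous (cdf G) := by
  rw [continuous_iff_continuousAt]
  intro x
  rw [(monotone_cdf G).continuousAt_iff_leftLim_eq_rightLim, StieltjesFunction.rightLim_eq]
  have h : G {x} = 0 := hG.measure_singleton x
  rw [← measure_cdf G, StieltjesFunction.measure_singleton, ENNReal.ofReal_eq_zero] at h
  exact le_antisymm ((monotone_cdf G).leftLim_le le_rfl) (by linarith)

theorem cdf_left (hG : WeightBounds G a b α) : cdf G a = 0 := by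
  rw [cdf_eq_real, measureReal_def, ← Set.Iio_union_right, measure_union_null, ENNReal.toReal_zero]
  · exact measure_mono_null (t := (Set.Icc a b)ᶜ) (fun x hx h => absurd hx (not_lt.2 h.1)) hG.support
  · exact hG.measure_singleton a

theorem cdf_right (hG : WeightBounds G a b α) : cdf G b = 1 := by
  rw [cdf_eq_real, measureReal_def, (prob_compl_eq_zero_iff measurableSet_Iic).1,
    ENNReal.toReal_one]
  exact measure_mono_null (Set.compl_subset_compl.2 fun x hx => hx.2) hG.support

theorem mul_le_cdf_sub (hG : WeightBounds G a b α) {x y : ℝ} (hx : a ≤ x) (hxy : x ≤ y)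
    (hy : y ≤ b) : α * (y - x) ≤ cdf G y - cdf G x := by
  have h := hG.le_measure x y hx hy
  rw [measure_Ioc, ENNReal.ofReal_le_ofReal_iff (sub_nonneg.2 (monotone_cdf G hxy))] at h
  exact h

theorem cdf_lt_cdf (hG : WeightBounds G a b α) {x y : ℝ} (hx : a ≤ x) (hxy : x < y)
    (hxb : x < b) : cdf G x < cdf G y := by
  have h := hG.mul_le_cdf_sub hx (le_min hxy.le hxb.le) (min_le_right y b)
  have h1 : 0 < α * (min y b - x) := mul_pos hG.α_pos (sub_pos.2 (lt_min hxy hxb))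
  have h2 := monotone_cdf G (min_le_left y b)
  linarith

theorem cdf_le_cdf_iff (hG : WeightBounds G a b α) {x y : ℝ} (hx : x ≤ b) (hy : a ≤ y) :
    cdf G x ≤ cdf G y ↔ x ≤ y := by
  refine ⟨fun h => ?_, fun h => monotone_cdf G h⟩
  by_contra! hlt
  exact absurd h (not_le.2 (hG.cdf_lt_cdf hy hlt (hlt.trans_le hx)))

theorem exists_cdf_eq (hG : WeightBounds G a b α) {s : ℝ} (hs : s ∈ Set.Icc (0 : ℝ) 1) :
    ∃ y ∈ Set.Icc a b, cdf G y = s := by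
  have h := intermediate_value_Icc hG.a_lt_b.le hG.continuous_cdf.continuousOn
  rw [hG.cdf_left, hG.cdf_right] at h
  exact h hs

end WeightBounds

/-! ### Tilting the density of one weight. -/

/-- The change of variables on the level of distribution functions. -/
noncomputable def tilt (τ s : ℝ) : ℝ := s - τ * min s (1 - s)

theorem tilt_lt_tilt {τ s s' : ℝ} (h0 : 0 ≤ τ) (h1 : τ < 1) (h : s < s') :
    tilt τ s < tilt τ s' := by
  unfold tilt
  rcases min_cases s (1 - s) with ⟨e, h2⟩ | ⟨e, h2⟩ <;>
  rcases min_cases s' (1 - s') with ⟨e', h2'⟩ | ⟨e', h2'⟩ <;> rw [e, e'] <;> nlinarith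

theorem tilt_le_tilt_iff {τ s s' : ℝ} (h0 : 0 ≤ τ) (h1 : τ < 1) :
    tilt τ s ≤ tilt τ s' ↔ s ≤ s' :=
  StrictMono.le_iff_le (f := tilt τ) fun _ _ h => tilt_lt_tilt h0 h1 h

theorem tilt_mem_Icc {τ s : ℝ} (h0 : 0 ≤ τ) (h1 : τ < 1) (hs : s ∈ Set.Icc (0 : ℝ) 1) :
    tilt τ s ∈ Set.Icc (0 : ℝ) 1 := by
  have e0 : tilt τ 0 = 0 := by simp [tilt]
  have e1 : tilt τ 1 = 1 := by simp [tilt]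
  exact ⟨e0 ▸ (tilt_le_tilt_iff h0 h1).2 hs.1, by
    have := (tilt_le_tilt_iff h0 h1).2 hs.2
    rwa [e1] at this⟩

/-- A change of density of relative size `τ` can be undone by a map `φ` decreasing each weight by
an amount of order `τ`. -/
structure IsTilting (G : Measure ℝ) (a b τ : ℝ) (φ : ℝ → ℝ) (L : ℝ → ENNReal) : Prop where
  measurable_map : Measurable φ
  measurable_density : Measurable L
  density_ne_top : ∀ x, L x ≠ ⊤
  lintegral_eq : ∫⁻ x, L x ∂G = 1
  lintegral_sq : ∫⁻ x, L x ^ 2 ∂G = ENNReal.ofReal (1 + τ ^ 2)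
  map_eq : (G.withDensity L).map φ = G
  mem_Icc : ∀ x, φ x ∈ Set.Icc a b
  cdf_eq : ∀ x, cdf G (φ x) = tilt τ (cdf G x)

namespace WeightBounds

variable {G : Measure ℝ} [IsProbabilityMeasure G] {a b α : ℝ}

/-- The tilted law has distribution function `tilt τ ∘ cdf G`, and `φ` is the quantile transform
solving `cdf G (φ x) = tilt τ (cdf G x)`. The density has mean one because the cut is made at a
median. -/
theorem exists_isTilting (hG : WeightBounds G a b α) {τ : ℝ} (h0 : 0 ≤ τ) (h1 : τ < 1) :
    ∃ φ L, IsTilting G a b τ φ L := by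
  have hF : ∀ x, cdf G x ∈ Set.Icc (0 : ℝ) 1 := fun x => ⟨cdf_nonneg G x, cdf_le_one G x⟩
  choose φ hφ hφF using fun x => hG.exists_cdf_eq (tilt_mem_Icc h0 h1 (hF x))
  obtain ⟨m, hm, hmF⟩ := hG.exists_cdf_eq (s := 1 / 2) (by norm_num)
  have hmono : Monotone φ := by
    intro x y hxy
    rw [← hG.cdf_le_cdf_iff (hφ x).2 (hφ y).1, hφF, hφF, tilt_le_tilt_iff h0 h1]
    exact monotone_cdf G hxy
  let L : ℝ → ENNReal := (Set.Iic m).piecewise (fun _ => ENNReal.ofReal (1 - τ))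
    (fun _ => ENNReal.ofReal (1 + τ))
  have hL : Measurable L := Measurable.piecewise measurableSet_Iic measurable_const measurable_const
  have hIic : ∀ c : ℝ, G (Set.Iic c) = ENNReal.ofReal (cdf G c) := fun c => (ofReal_cdf G c).symm
  have hIoi : G (Set.Iic m)ᶜ = ENNReal.ofReal (1 / 2) := by
    rw [prob_compl_eq_one_sub measurableSet_Iic, hIic, hmF, ← ENNReal.ofReal_one,
      ← ENNReal.ofReal_sub _ (by norm_num)]
    norm_num
  have hint : ∀ f : ENNReal → ENNReal, ∫⁻ x, f (L x) ∂G =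
      f (ENNReal.ofReal (1 - τ)) * ENNReal.ofReal (1 / 2) +
      f (ENNReal.ofReal (1 + τ)) * ENNReal.ofReal (1 / 2) := by
    intro f
    rw [← lintegral_add_compl _ (measurableSet_Iic (a := m)),
      setLIntegral_congr_fun (g := fun _ => f (ENNReal.ofReal (1 - τ))) measurableSet_Iic,
      setLIntegral_congr_fun (g := fun _ => f (ENNReal.ofReal (1 + τ))) measurableSet_Iic.compl,
      setLIntegral_const, setLIntegral_const, hIoi, hIic, hmF]
    · intro x hx
      simp only [L, Set.piecewise_eq_of_notMem _ _ _ hx]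
    · intro x hx
      simp only [L, Set.piecewise_eq_of_mem _ _ _ hx]
  have hdens : ∀ z, (G.withDensity L) (Set.Iic z) = ENNReal.ofReal (tilt τ (cdf G z)) := by
    intro z
    rw [withDensity_apply _ measurableSet_Iic,
      ← lintegral_add_compl _ (measurableSet_Iic (a := m)),
      Measure.restrict_restrict measurableSet_Iic,
      Measure.restrict_restrict measurableSet_Iic.compl,
      setLIntegral_congr_fun (g := fun _ => ENNReal.ofReal (1 - τ))
        (measurableSet_Iic.inter measurableSet_Iic),
      setLIntegral_congr_fun (g := fun _ => ENNReal.ofReal (1 + τ))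
        (measurableSet_Iic.compl.inter measurableSet_Iic),
      setLIntegral_const, setLIntegral_const, Set.compl_Iic, Set.Ioi_inter_Iic, measure_Ioc,
      Set.Iic_inter_Iic, hIic, ← ENNReal.ofReal_mul (by linarith), ← ENNReal.ofReal_mul (by linarith),
      hmF]
    · rcases le_total z m with hz | hz
      · have hz' := monotone_cdf G hz
        rw [hmF] at hz'
        rw [show m ⊓ z = z from inf_eq_right.2 hz, ENNReal.ofReal_of_nonpos (p := (1 + τ) * _)
          (by nlinarith), add_zero, tilt, min_eq_left (by linarith)]
        congr 1
        ring
      · have hz' := monotone_cdf G hz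
        rw [hmF] at hz'
        rw [show m ⊓ z = m from inf_eq_left.2 hz, hmF, ← ENNReal.ofReal_add (by nlinarith)
          (by nlinarith), tilt, min_eq_right (by linarith)]
        congr 1
        ring
    · intro x hx
      simp only [L, Set.piecewise_eq_of_notMem _ _ _ hx.1]
    · intro x hx
      simp only [L, Set.piecewise_eq_of_mem _ _ _ hx.1]
  have hL1 : ∫⁻ x, L x ∂G = 1 := by
    rw [hint fun x => x, ← ENNReal.ofReal_mul (by linarith), ← ENNReal.ofReal_mul (by linarith),
      ← ENNReal.ofReal_add (by nlinarith) (by nlinarith), ← ENNReal.ofReal_one]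
    congr 1
    ring
  have hL2 : ∫⁻ x, L x ^ 2 ∂G = ENNReal.ofReal (1 + τ ^ 2) := by
    rw [hint fun x => x ^ 2, ← ENNReal.ofReal_pow (by linarith), ← ENNReal.ofReal_pow (by linarith),
      ← ENNReal.ofReal_mul (by positivity), ← ENNReal.ofReal_mul (by positivity),
      ← ENNReal.ofReal_add (by positivity) (by positivity)]
    congr 1
    ring
  have : IsFiniteMeasure (G.withDensity L) := isFiniteMeasure_withDensity (by simp [hL1])
  refine ⟨φ, L, hmono.measurable, hL, fun x => ?_, hL1, hL2, ?_, hφ, hφF⟩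
  · by_cases hx : x ∈ Set.Iic m
    · simp only [L, Set.piecewise_eq_of_mem _ _ _ hx, ne_eq, ENNReal.ofReal_ne_top,
        not_false_eq_true]
    · simp only [L, Set.piecewise_eq_of_notMem _ _ _ hx, ne_eq, ENNReal.ofReal_ne_top,
        not_false_eq_true]
  refine Measure.ext_of_Iic _ _ fun y => ?_
  rw [Measure.map_apply hmono.measurable measurableSet_Iic, hIic]
  rcases lt_or_ge y a with hya | hya
  · have he : φ ⁻¹' Set.Iic y = ∅ := by
      ext x
      simpa using hya.trans_le (hφ x).1
    have hy0 : cdf G y = 0 := le_antisymm (hG.cdf_left ▸ monotone_cdf G hya.le) (cdf_nonneg G y)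
    simp [he, hy0]
  rcases le_or_gt b y with hyb | hyb
  · have he : φ ⁻¹' Set.Iic y = Set.univ := by
      ext x
      simpa using (hφ x).2.trans hyb
    have hy0 : cdf G y = 1 := le_antisymm (cdf_le_one G y) (hG.cdf_right ▸ monotone_cdf G hyb)
    rw [he, hy0, withDensity_apply _ MeasurableSet.univ, Measure.restrict_univ, hL1,
      ENNReal.ofReal_one]
  -- For `y ∈ [a, b)` the preimage of `Iic y` under `φ` is `Iic z`, where `z < b` solves `tilt τ
  -- (cdf G z) = cdf G y`.
  · have hcont : ContinuousOn (fun x => tilt τ (cdf G x)) (Set.Icc a b) := by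
      have := hG.continuous_cdf
      unfold tilt
      fun_prop
    have hivt := intermediate_value_Icc hG.a_lt_b.le hcont
    rw [hG.cdf_left, hG.cdf_right] at hivt
    simp only [tilt, min_eq_left, sub_zero, zero_le_one, mul_zero, sub_self, min_eq_right] at hivt
    obtain ⟨z, hz, hzy⟩ := hivt (hF y)
    change tilt τ (cdf G z) = _ at hzy
    have hzb : z < b := by
      refine lt_of_le_of_ne hz.2 ?_
      rintro rfl
      rw [hG.cdf_right] at hzy
      have := hG.cdf_lt_cdf hya hyb hyb
      rw [hG.cdf_right, ← hzy] at this
      simp [tilt] at this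
    have he : φ ⁻¹' Set.Iic y = Set.Iic z := by
      ext x
      rw [Set.mem_preimage, Set.mem_Iic, Set.mem_Iic, ← hG.cdf_le_cdf_iff (hφ x).2 hya, hφF,
        ← hzy, tilt_le_tilt_iff h0 h1]
      refine ⟨fun h => ?_, fun h => monotone_cdf G h⟩
      by_contra! hlt
      exact absurd h (not_le.2 (hG.cdf_lt_cdf hz.1 hlt hzb))
    rw [he, hdens, hzy]

end WeightBounds

namespace IsTilting

variable {G : Measure ℝ} [IsProbabilityMeasure G] {a b α τ : ℝ} {φ : ℝ → ℝ} {L : ℝ → ENNReal}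

theorem map_le (hG : WeightBounds G a b α) (h : IsTilting G a b τ φ L) (h0 : 0 ≤ τ) {x : ℝ}
    (hx : x ∈ Set.Icc a b) : φ x ≤ x := by
  rw [← hG.cdf_le_cdf_iff (h.mem_Icc x).2 hx.1, h.cdf_eq, tilt]
  have h2 : 0 ≤ min (cdf G x) (1 - cdf G x) :=
    le_min (cdf_nonneg G x) (sub_nonneg.2 (cdf_le_one G x))
  nlinarith

/-- The distribution function moves by at most `τ` and has slope at least `α` on `[a, b]`. -/
theorem sub_map_le (hG : WeightBounds G a b α) (h : IsTilting G a b τ φ L) (h0 : 0 ≤ τ) {x : ℝ}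
    (hx : x ∈ Set.Icc a b) : x - φ x ≤ τ / α := by
  have h1 := hG.mul_le_cdf_sub (h.mem_Icc x).1 (h.map_le hG h0 hx) hx.2
  rw [h.cdf_eq, tilt] at h1
  rw [le_div_iff₀ hG.α_pos]
  have h2 : min (cdf G x) (1 - cdf G x) ≤ 1 := (min_le_left _ _).trans (cdf_le_one G x)
  nlinarith

end IsTilting

/-- Weights which are increased by at least `κ * τ` when a tilting of size `τ` is undone. -/
def robustWeights (G : Measure ℝ) (a b κ : ℝ) : Set ℝ :=
  {x | x ∈ Set.Icc a b ∧ ∀ y ≤ x, ∀ τ : ℝ, 0 ≤ τ → cdf G y = tilt τ (cdf G x) → κ * τ ≤ x - y}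

/-- The displacement is small only where the density is large or near the endpoints of the support.
A monotone function is differentiable almost everywhere, so for `G`-almost every `x` the left
difference quotients of `cdf G` at `x` are bounded and `0 < cdf G x < 1`. The sets `A n` make both
facts quantitative and exhaust almost everything. -/
theorem WeightBounds.exists_robustWeights {G : Measure ℝ} [IsProbabilityMeasure G] {a b α : ℝ}
    (hG : WeightBounds G a b α) {p : ENNReal} (hp : 0 < p) :
    ∃ κ : ℝ, 0 < κ ∧ ∃ A : Set ℝ, MeasurableSet A ∧ A ⊆ robustWeights G a b κ ∧ G Aᶜ < p := by
  let A : ℕ → Set ℝ := fun n => Set.Icc a b ∩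
    ((⋂ h : Set.Ici (0 : ℝ), {x | cdf G x - cdf G (x - h) ≤ (n + 1) * h}) ∩
      {x | 1 ≤ (n + 1) * min (cdf G x) (1 - cdf G x)})
  have hc := hG.continuous_cdf
  have hA : ∀ n, MeasurableSet (A n) := by
    intro n
    refine (isClosed_Icc.inter ((isClosed_iInter fun h => ?_).inter ?_)).measurableSet
    · exact isClosed_le (by fun_prop) (by fun_prop)
    · exact isClosed_le (by fun_prop) (by fun_prop)
  have hanti : Antitone fun n => (A n)ᶜ := by
    intro n n' hn
    refine Set.compl_subset_compl.2 ?_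
    rintro x ⟨hx, hx1, hx2⟩
    have hn' : (n : ℝ) ≤ n' := by exact_mod_cast hn
    refine ⟨hx, ?_, ?_⟩
    · simp only [Set.mem_iInter] at hx1 ⊢
      intro h
      refine le_trans (b := ((n : ℝ) + 1) * h) (hx1 h) ?_
      have : (0 : ℝ) ≤ h := h.2
      gcongr
    · simp only [Set.mem_ofPred_eq] at hx2 ⊢
      refine hx2.trans ?_
      have : 0 ≤ min (cdf G x) (1 - cdf G x) :=
        le_min (cdf_nonneg G x) (sub_nonneg.2 (cdf_le_one G x))
      gcongr
  have hnull : G (⋂ n, (A n)ᶜ) = 0 := by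
    have hdiff : ∀ᵐ x ∂G, DifferentiableAt ℝ (cdf G) x :=
      hG.absolutelyContinuous.ae_le (monotone_cdf G).ae_differentiableAt
    have hae : ∀ᵐ x ∂G, x ∈ Set.Icc a b := by
      rw [ae_iff]
      exact hG.support
    have hnea : ∀ᵐ x ∂G, x ≠ a := by
      rw [ae_iff]; simp [hG.measure_singleton]
    have hneb : ∀ᵐ x ∂G, x ≠ b := by
      rw [ae_iff]; simp [hG.measure_singleton]
    have : ∀ᵐ x ∂G, x ∉ ⋂ n, (A n)ᶜ := by
      filter_upwards [hdiff, hae, hnea, hneb] with x hd hx hxa hxb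
      simp only [Set.mem_iInter, Set.mem_compl_iff, not_forall, not_not]
      obtain ⟨C, hC⟩ := hd.isBigO_sub.bound
      obtain ⟨ε, hε, hball⟩ := Metric.eventually_nhds_iff.1 hC
      have hlow : 0 < cdf G x := by
        have := hG.cdf_lt_cdf le_rfl (lt_of_le_of_ne hx.1 hxa.symm) hG.a_lt_b
        rwa [hG.cdf_left] at this
      have hup : cdf G x < 1 := by
        have := hG.cdf_lt_cdf hx.1 (lt_of_le_of_ne hx.2 hxb) (lt_of_le_of_ne hx.2 hxb)
        rwa [hG.cdf_right] at this
      have hmin : 0 < min (cdf G x) (1 - cdf G x) := lt_min hlow (by linarith)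
      obtain ⟨n, hn⟩ := exists_nat_ge (max (max C (1 / ε)) (1 / min (cdf G x) (1 - cdf G x)))
      have hn1 : C ≤ n := (le_max_left _ _).trans ((le_max_left _ _).trans hn)
      have hn2 : 1 / ε ≤ n := (le_max_right _ _).trans ((le_max_left _ _).trans hn)
      have hn3 : 1 / min (cdf G x) (1 - cdf G x) ≤ n := (le_max_right _ _).trans hn
      rw [div_le_iff₀ hε] at hn2
      rw [div_le_iff₀ hmin] at hn3
      refine ⟨n, hx, ?_, ?_⟩
      · simp only [Set.mem_iInter]
        rintro ⟨h, hh⟩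
        have hh : 0 ≤ h := hh
        simp only [Set.mem_ofPred_eq]
        rcases lt_or_ge h ε with hlt | hge
        · have := hball (y := x - h) (by simpa [abs_of_nonneg hh] using hlt)
          simp only [sub_sub_cancel_left, norm_neg, Real.norm_eq_abs, abs_of_nonneg hh] at this
          rw [abs_sub_comm] at this
          have h3 := le_abs_self (cdf G x - cdf G (x - h))
          nlinarith
        · have h3 := cdf_nonneg G (x - h)
          have h4 : (n : ℝ) * ε ≤ n * h := by gcongr
          nlinarith
      · simp only [Set.mem_ofPred_eq]
        nlinarith
    simpa only [ae_iff, not_not, Set.ofPred_mem_eq] using this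
  have htend := tendsto_measure_iInter_atTop (μ := G) (fun n => (hA n).compl.nullMeasurableSet)
    hanti ⟨0, measure_ne_top _ _⟩
  rw [hnull] at htend
  obtain ⟨n, hn⟩ := (htend.eventually_lt_const hp).exists
  -- One factor `n + 1` bounds the difference quotient, the other `1 / min (cdf G x) (1 - cdf G x)`.
  refine ⟨1 / ((n : ℝ) + 1) ^ 2, by positivity, A n, hA n, ?_, hn⟩
  rintro x ⟨hx, hx1, hx2⟩
  refine ⟨hx, fun y hy τ hτ hF => ?_⟩
  simp only [Set.mem_iInter] at hx1
  have h1 := hx1 ⟨x - y, sub_nonneg.2 hy⟩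
  simp only [Set.mem_ofPred_eq, sub_sub_cancel] at h1 hx2
  rw [hF, tilt, sub_sub_cancel] at h1
  have hn0 : (0 : ℝ) < n + 1 := by positivity
  rw [div_mul_eq_mul_div, one_mul, div_le_iff₀ (by positivity)]
  calc τ = τ * 1 := (mul_one τ).symm
    _ ≤ τ * ((n + 1) * min (cdf G x) (1 - cdf G x)) := by gcongr
    _ = (n + 1) * (τ * min (cdf G x) (1 - cdf G x)) := by ring
    _ ≤ (n + 1) * ((n + 1) * (x - y)) := by gcongr
    _ = (x - y) * (n + 1) ^ 2 := by ring

/-! ### Independent weights and tilting on finitely many edges. -/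

section Product

variable {ι : Type*} {G : Measure ℝ} [IsProbabilityMeasure G]

/-- The law of i.i.d. weights. -/
noncomputable def iidLaw (ι : Type*) (G : Measure ℝ) [IsProbabilityMeasure G] : Measure (ι → ℝ) :=
  Measure.infinitePi fun _ => G

instance : IsProbabilityMeasure (iidLaw ι G) := by
  unfold iidLaw
  infer_instance

theorem iidLaw_map_eval (e : ι) : (iidLaw ι G).map (fun t => t e) = G :=
  Measure.infinitePi_map_eval _ e

theorem lintegral_eval_iidLaw {f : ℝ → ENNReal} (hf : Measurable f) (e : ι) :
    ∫⁻ t, f (t e) ∂(iidLaw ι G) = ∫⁻ x, f x ∂G := by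
  rw [← lintegral_map hf (measurable_pi_apply e), iidLaw_map_eval]

theorem lintegral_prod_iidLaw (s : Finset ι) {f : ι → ℝ → ENNReal} (hf : ∀ e, Measurable (f e)) :
    ∫⁻ t, ∏ e ∈ s, f e (t e) ∂(iidLaw ι G) = ∏ e ∈ s, ∫⁻ x, f e x ∂G := by
  have hind : iIndepFun (fun e (t : ι → ℝ) => f e (t e)) (iidLaw ι G) := iIndepFun_infinitePi hf
  rw [lintegral_prod_eq_prod_lintegral_of_indepFun s _ hind fun e =>
    (hf e).comp (measurable_pi_apply e)]
  exact Finset.prod_congr rfl fun e _ => lintegral_eval_iidLaw (hf e) e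

/-- The weight at `e₀` is independent of the remaining sum and has no atoms; Fubini concludes. -/
theorem ae_sum_ne_zero (hG : ∀ x, G {x} = 0) (s : Finset ι) (c : ι → ℝ) {e₀ : ι} (he₀ : e₀ ∉ s) :
    ∀ᵐ t ∂(iidLaw ι G), t e₀ + ∑ e ∈ s, c e * t e ≠ 0 := by
  classical
  let f : ι → ℝ → ℝ := fun e x => if e = e₀ then x else c e * x
  have hf : ∀ e, Measurable (f e) := by
    intro e
    by_cases h : e = e₀ <;> simp only [f, h, if_true, if_false] <;> fun_prop
  have hind : iIndepFun (fun e (t : ι → ℝ) => f e (t e)) (iidLaw ι G) := iIndepFun_infinitePi hf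
  have h2 := (hind.indepFun_finsetSum_of_notMem
    (fun e => (hf e).comp (measurable_pi_apply e)) he₀).symm
  have hX : (fun t : ι → ℝ => f e₀ (t e₀)) = fun t => t e₀ := by
    ext t; simp [f]
  have hY : (∑ e ∈ s, fun t : ι → ℝ => f e (t e)) = fun t => ∑ e ∈ s, c e * t e := by
    ext t
    rw [Finset.sum_apply]
    refine Finset.sum_congr rfl fun e he => ?_
    have : e ≠ e₀ := fun h => he₀ (h ▸ he)
    simp [f, this]
  rw [hX, hY] at h2
  have hYm : Measurable fun t : ι → ℝ => ∑ e ∈ s, c e * t e := by fun_prop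
  have hXm : Measurable fun t : ι → ℝ => t e₀ := by fun_prop
  rw [indepFun_iff_map_prod_eq_prod_map_map hXm.aemeasurable hYm.aemeasurable] at h2
  have hS : MeasurableSet {z : ℝ × ℝ | z.1 + z.2 = 0} :=
    measurableSet_eq_fun (by fun_prop) (by fun_prop)
  have hpre : {t : ι → ℝ | ¬ t e₀ + ∑ e ∈ s, c e * t e ≠ 0} =
      (fun t : ι → ℝ => (t e₀, ∑ e ∈ s, c e * t e)) ⁻¹' {z : ℝ × ℝ | z.1 + z.2 = 0} := by
    ext t; simp
  have := Measure.isProbabilityMeasure_map (μ := iidLaw ι G) hYm.aemeasurable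
  rw [ae_iff, hpre, ← Measure.map_apply (by fun_prop) hS, h2, iidLaw_map_eval,
    Measure.prod_apply_symm hS]
  simp only [lintegral_eq_zero_iff' (measurable_measure_prodMk_right hS).aemeasurable]
  refine Filter.Eventually.of_forall fun y => ?_
  have : (fun x => (x, y)) ⁻¹' {z : ℝ × ℝ | z.1 + z.2 = 0} = {-y} := by
    ext x
    simp [eq_neg_iff_add_eq_zero]
  change G ((fun x => (x, y)) ⁻¹' {z : ℝ × ℝ | z.1 + z.2 = 0}) = 0
  rw [this, hG]

open Classical in
/-- Apply `φ` to the weights in `R`. -/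
noncomputable def transformOn (R : Finset ι) (φ : ℝ → ℝ) (t : ι → ℝ) : ι → ℝ :=
  fun e => if e ∈ R then φ (t e) else t e

theorem measurable_transformOn (R : Finset ι) {φ : ℝ → ℝ} (hφ : Measurable φ) :
    Measurable (transformOn R φ) := by
  refine measurable_pi_lambda _ fun e => ?_
  by_cases h : e ∈ R <;> simp only [transformOn, h, if_true, if_false] <;> fun_prop

/-- The law of the weights with the density changed on `R`. -/
noncomputable def tiltedLaw (G : Measure ℝ) [IsProbabilityMeasure G] (R : Finset ι)
    (L : ℝ → ENNReal) : Measure (ι → ℝ) :=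
  (iidLaw ι G).withDensity fun t => ∏ e ∈ R, L (t e)

variable {a b τ : ℝ} {φ : ℝ → ℝ} {L : ℝ → ENNReal}

/-- Tested on cylinder sets, the integral factorizes over `s ∪ R`; each factor reduces to the
one-weight identity `map_eq` or to total mass one. -/
theorem IsTilting.tiltedLaw_map (h : IsTilting G a b τ φ L) (R : Finset ι) :
    (tiltedLaw G R L).map (transformOn R φ) = iidLaw ι G := by
  classical
  refine Measure.eq_infinitePi _ fun s u hu => ?_
  have hms : MeasurableSet ((s : Set ι).pi u) := MeasurableSet.pi s.countable_toSet fun e _ => hu e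
  have hmT := measurable_transformOn R h.measurable_map
  let g : ι → ℝ → ENNReal := fun e x => (if e ∈ R then L x else 1) *
    (if e ∈ s then (if e ∈ R then φ ⁻¹' u e else u e).indicator 1 x else 1)
  have hmu : ∀ e, MeasurableSet (if e ∈ R then φ ⁻¹' u e else u e) := by
    intro e
    split_ifs
    · exact h.measurable_map (hu e)
    · exact hu e
  have hg : ∀ e, Measurable (g e) := by
    intro e
    refine Measurable.mul ?_ ?_
    · by_cases he : e ∈ R <;> simp only [he, if_true, if_false]
      · exact h.measurable_density
      · exact measurable_const
    · by_cases he : e ∈ s <;> simp only [he, if_true, if_false]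
      · exact measurable_one.indicator (hmu e)
      · exact measurable_const
  have hint : ∀ e, e ∈ s ∪ R → ∫⁻ x, g e x ∂G = if e ∈ s then G (u e) else 1 := by
    intro e he
    by_cases hs : e ∈ s <;> by_cases hR : e ∈ R
    · simp only [g, hs, hR, if_true]
      conv_rhs => rw [← h.map_eq, Measure.map_apply h.measurable_map (hu e),
        withDensity_apply _ (h.measurable_map (hu e)),
        ← lintegral_indicator (h.measurable_map (hu e))]
      congr 1 with x
      by_cases hx : x ∈ φ ⁻¹' u e <;> simp [hx]
    · simp only [g, hs, hR, if_true, if_false, one_mul]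
      exact lintegral_indicator_one (hu e)
    · simp only [g, hs, hR, if_true, if_false, mul_one]
      exact h.lintegral_eq
    · simp [hs, hR] at he
  have hpt : ∀ t : ι → ℝ, (transformOn R φ ⁻¹' (s : Set ι).pi u).indicator
      (fun t => ∏ e ∈ R, L (t e)) t = ∏ e ∈ s ∪ R, g e (t e) := by
    intro t
    simp only [g, Finset.prod_mul_distrib]
    have h1 : ∏ e ∈ s ∪ R, (if e ∈ R then L (t e) else 1) = ∏ e ∈ R, L (t e) := by
      rw [Finset.prod_ite_mem, Finset.union_inter_cancel_right]
    rw [h1, Finset.prod_ite_mem, Finset.union_inter_cancel_left]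
    by_cases ht : t ∈ transformOn R φ ⁻¹' (s : Set ι).pi u
    · rw [Set.indicator_of_mem ht, Finset.prod_eq_one (s := s), mul_one]
      intro e he
      refine Set.indicator_of_mem ?_ _
      have := ht e he
      by_cases hR : e ∈ R <;> simpa [transformOn, hR] using this
    · rw [Set.indicator_of_notMem ht]
      simp only [Set.mem_preimage, Set.mem_pi, not_forall] at ht
      obtain ⟨e, he, hte⟩ := ht
      rw [Finset.prod_eq_zero (i := e) (s := s) he, mul_zero]
      refine Set.indicator_of_notMem ?_ _
      by_cases hR : e ∈ R <;> simpa [transformOn, hR] using hte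
  rw [Measure.map_apply hmT hms, tiltedLaw, withDensity_apply _ (hmT hms),
    ← lintegral_indicator (hmT hms), lintegral_congr hpt, lintegral_prod_iidLaw _ hg,
    Finset.prod_congr rfl hint, Finset.prod_ite_mem, Finset.union_inter_cancel_left]

theorem IsTilting.isProbabilityMeasure (h : IsTilting G a b τ φ L) (R : Finset ι) :
    IsProbabilityMeasure (tiltedLaw G R L) := by
  refine ⟨?_⟩
  rw [tiltedLaw, withDensity_apply _ MeasurableSet.univ, Measure.restrict_univ,
    lintegral_prod_iidLaw R fun _ => h.measurable_density]
  simp [h.lintegral_eq]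

/-- A chi-square bound: the likelihood ratio `Λ` has mean one and second moment `(1 + τ²)^|R|`, and
`1 - Λ ≤ ((1 - Λ)²/δ + δ)/2` pointwise. -/
theorem IsTilting.measureReal_le (h : IsTilting G a b τ φ L) (R : Finset ι) {δ : ℝ} (hδ : 0 < δ)
    (hR : (1 + τ ^ 2) ^ R.card - 1 ≤ δ ^ 2) {B : Set (ι → ℝ)} (hB : MeasurableSet B) :
    (iidLaw ι G).real B ≤ (tiltedLaw G R L).real B + δ := by
  let Λ : (ι → ℝ) → ℝ := fun t => (∏ e ∈ R, L (t e)).toReal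
  have hΛm : Measurable Λ := by
    have := h.measurable_density
    fun_prop
  have hΛ0 : ∀ t, 0 ≤ Λ t := fun t => ENNReal.toReal_nonneg
  have hΛ : ∀ t, ENNReal.ofReal (Λ t) = ∏ e ∈ R, L (t e) := fun t =>
    ENNReal.ofReal_toReal (ENNReal.prod_ne_top fun e _ => h.density_ne_top _)
  have hl1 : ∫⁻ t, ENNReal.ofReal (Λ t) ∂(iidLaw ι G) = 1 := by
    simp only [hΛ, lintegral_prod_iidLaw R fun _ => h.measurable_density, h.lintegral_eq]
    simp
  have hl2 : ∫⁻ t, ENNReal.ofReal (Λ t ^ 2) ∂(iidLaw ι G) =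
      ENNReal.ofReal ((1 + τ ^ 2) ^ R.card) := by
    have : ∀ t : ι → ℝ, ENNReal.ofReal (Λ t ^ 2) = ∏ e ∈ R, L (t e) ^ 2 := by
      intro t
      rw [ENNReal.ofReal_pow (hΛ0 t), hΛ, Finset.prod_pow]
    simp only [this]
    rw [lintegral_prod_iidLaw (G := G) R (f := fun _ x => L x ^ 2)
      fun _ => h.measurable_density.pow_const 2, h.lintegral_sq]
    rw [Finset.prod_const, ENNReal.ofReal_pow (by positivity)]
  have hi1 : Integrable Λ (iidLaw ι G) := by
    rw [← lintegral_ofReal_ne_top_iff_integrable hΛm.aestronglyMeasurable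
      (Filter.Eventually.of_forall hΛ0), hl1]
    simp
  have hi2 : Integrable (fun t => Λ t ^ 2) (iidLaw ι G) := by
    rw [← lintegral_ofReal_ne_top_iff_integrable (hΛm.pow_const 2).aestronglyMeasurable
      (Filter.Eventually.of_forall fun t => sq_nonneg _), hl2]
    simp
  have he1 : ∫ t, Λ t ∂(iidLaw ι G) = 1 := by
    rw [integral_eq_lintegral_of_nonneg_ae (Filter.Eventually.of_forall hΛ0)
      hΛm.aestronglyMeasurable, hl1, ENNReal.toReal_one]
  have he2 : ∫ t, Λ t ^ 2 ∂(iidLaw ι G) = (1 + τ ^ 2) ^ R.card := by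
    rw [integral_eq_lintegral_of_nonneg_ae (Filter.Eventually.of_forall fun t => sq_nonneg _)
      (hΛm.pow_const 2).aestronglyMeasurable, hl2, ENNReal.toReal_ofReal (by positivity)]
  have hreal : (tiltedLaw G R L).real B = ∫ t in B, Λ t ∂(iidLaw ι G) := by
    rw [integral_eq_lintegral_of_nonneg_ae (Filter.Eventually.of_forall hΛ0)
      hΛm.aestronglyMeasurable, measureReal_def, tiltedLaw, withDensity_apply _ hB]
    simp only [hΛ]
  have hconst : (iidLaw ι G).real B = ∫ t in B, (1 : ℝ) ∂(iidLaw ι G) := by simp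
  have hiq : Integrable (fun t => ((1 - 2 * Λ t + Λ t ^ 2) / δ + δ) / 2) (iidLaw ι G) := by
    fun_prop
  have hbound : ∫ t in B, (1 - Λ t) ∂(iidLaw ι G) ≤ δ := by
    calc ∫ t in B, (1 - Λ t) ∂(iidLaw ι G)
        ≤ ∫ t in B, ((1 - 2 * Λ t + Λ t ^ 2) / δ + δ) / 2 ∂(iidLaw ι G) := by
          refine integral_mono ((integrable_const 1).sub hi1.restrict) hiq.restrict fun t => ?_
          change 1 - Λ t ≤ ((1 - 2 * Λ t + Λ t ^ 2) / δ + δ) / 2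
          rw [le_div_iff₀ two_pos, div_add' _ _ _ hδ.ne', le_div_iff₀ hδ]
          nlinarith [sq_nonneg (1 - Λ t - δ)]
      _ ≤ ∫ t, ((1 - 2 * Λ t + Λ t ^ 2) / δ + δ) / 2 ∂(iidLaw ι G) := by
          refine setIntegral_le_integral hiq (Filter.Eventually.of_forall fun t => ?_)
          change 0 ≤ ((1 - 2 * Λ t + Λ t ^ 2) / δ + δ) / 2
          have : 0 ≤ 1 - 2 * Λ t + Λ t ^ 2 := by nlinarith [sq_nonneg (1 - Λ t)]
          positivity
      _ = (((1 + τ ^ 2) ^ R.card - 1) / δ + δ) / 2 := by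
          rw [integral_div, integral_add (by fun_prop) (by fun_prop), integral_div,
            integral_add (by fun_prop) (by fun_prop), integral_sub (by fun_prop) (by fun_prop),
            integral_const_mul, he1, he2]
          simp
          ring
      _ ≤ (δ ^ 2 / δ + δ) / 2 := by gcongr
      _ = δ := by field_simp; ring
  rw [integral_sub (integrable_const 1) hi1.restrict, ← hreal, ← hconst] at hbound
  linarith

end Product

/-! ### Almost sure regularity and the union bound over paths. -/

/-- The difference of the passage times of two distinct paths contains the weight of a separating
edge with coefficient one, so it almost surely does not vanish. -/
theorem ae_isRegular {G : Measure ℝ} [IsProbabilityMeasure G] {a b α : ℝ}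
    (hG : WeightBounds G a b α) : ∀ᵐ t ∂(iidLaw (Edge d) G), IsRegular a b t := by
  classical
  have hae : ∀ᵐ x ∂G, x ∈ Set.Icc a b := by
    rw [ae_iff]
    exact hG.support
  have h1 : ∀ᵐ t ∂(iidLaw (Edge d) G), ∀ e, t e ∈ Set.Icc a b := by
    rw [ae_all_iff]
    intro e
    have : ∀ᵐ x ∂((iidLaw (Edge d) G).map fun t => t e), x ∈ Set.Icc a b := by
      rwa [iidLaw_map_eval]
    exact ae_of_ae_map (measurable_pi_apply e).aemeasurable this
  have h2 : ∀ᵐ t ∂(iidLaw (Edge d) G), ∀ (x y : Fin d → ℤ) (p q : (lattice d).Walk x y),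
      p.IsPath → q.IsPath → p ≠ q → passageTime t p ≠ passageTime t q := by
    simp only [ae_all_iff]
    intro x y p q hp hq hne
    obtain ⟨e₀, heq, hep⟩ : ∃ e ∈ edgeList q, e ∉ edgeList p := by
      by_contra! hcon
      refine hne (eq_of_edges_subset hp hq fun e he => ?_).symm
      exact mem_edgeList.1 (hcon ⟨e, q.edges_subset_edgeSet he⟩ (mem_edgeList.2 he))
    let s := ((edgeList p).toFinset ∪ (edgeList q).toFinset).erase e₀
    let c : Edge d → ℝ := fun e => (if e ∈ edgeList q then 1 else 0) -
      (if e ∈ edgeList p then 1 else 0)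
    filter_upwards [ae_sum_ne_zero hG.measure_singleton s c (Finset.notMem_erase e₀ _)] with t ht
    have hT : ∀ {r : (lattice d).Walk x y}, r.IsPath → (edgeList r).toFinset ⊆ insert e₀ s →
        passageTime t r = ∑ e ∈ insert e₀ s, (if e ∈ edgeList r then 1 else 0) * t e := by
      intro r hr hsub
      rw [passageTime_eq_sum_edgeList, ← List.sum_toFinset t (nodup_edgeList hr)]
      simp only [ite_mul, one_mul, zero_mul]
      rw [← Finset.sum_filter]
      refine Finset.sum_congr ?_ fun _ _ => rfl
      ext e
      simp only [List.mem_toFinset, Finset.mem_filter]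
      exact ⟨fun he => ⟨hsub (List.mem_toFinset.2 he), he⟩, fun he => he.2⟩
    have hins : insert e₀ s = (edgeList p).toFinset ∪ (edgeList q).toFinset :=
      Finset.insert_erase (Finset.mem_union_right _ (List.mem_toFinset.2 heq))
    intro hTT
    apply ht
    have h3 : ∑ e ∈ insert e₀ s, c e * t e = 0 := by
      simp only [c, sub_mul, Finset.sum_sub_distrib]
      rw [← hT hq (hins ▸ Finset.subset_union_right), ← hT hp (hins ▸ Finset.subset_union_left),
        hTT, sub_self]
    have hc : c e₀ = 1 := by simp [c, heq, hep]
    rwa [Finset.sum_insert (Finset.notMem_erase e₀ _), hc, one_mul] at h3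
  filter_upwards [h1, h2] with t ht ht'
  exact ⟨fun e => (ht e).1, fun e => (ht e).2, ht'⟩

theorem iidLaw_forall_mem {ι : Type*} {G : Measure ℝ} [IsProbabilityMeasure G] (s : Finset ι)
    {A : Set ℝ} (hA : MeasurableSet A) :
    iidLaw ι G {t | ∀ e ∈ s, t e ∈ A} = G A ^ s.card := by
  have : {t : ι → ℝ | ∀ e ∈ s, t e ∈ A} = (s : Set ι).pi fun _ => A := by
    ext t; simp [Set.mem_pi]
  rw [this, iidLaw, Measure.infinitePi_pi _ fun _ _ => hA, Finset.prod_const]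

open Classical in
/-- The edges of a walk, as a finite set. -/
noncomputable def edgeFinset {x y : Fin d → ℤ} (p : (lattice d).Walk x y) : Finset (Edge d) :=
  (edgeList p).toFinset

theorem mem_edgeFinset {x y : Fin d → ℤ} {p : (lattice d).Walk x y} {e : Edge d} :
    e ∈ edgeFinset p ↔ e ∈ edgeList p := by
  simp [edgeFinset]

theorem passageTime_eq_sum {x y : Fin d → ℤ} {p : (lattice d).Walk x y} (hp : p.IsPath)
    (t : Edge d → ℝ) : passageTime t p = ∑ e ∈ edgeFinset p, t e := by
  rw [passageTime_eq_sum_edgeList, edgeFinset, List.sum_toFinset t (nodup_edgeList hp)]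

open Classical in
/-- Paths from `x` which are not too long contain few edges with exceptional weights. -/
theorem exists_few_exceptional {G : Measure ℝ} [IsProbabilityMeasure G] {A : Set ℝ}
    (hA : MeasurableSet A) (x : Fin d → ℤ) (K k : ℕ) :
    ∃ B : Set (Edge d → ℝ), MeasurableSet B ∧
      iidLaw (Edge d) G B ≤ (4 * 3 ^ d) ^ K * G Aᶜ ^ k ∧
      ∀ t ∉ B, ∀ (y : Fin d → ℤ) (p : (lattice d).Walk x y), p.IsPath → p.length ≤ K →
        ((edgeFinset p).filter fun e => t e ∉ A).card < k := by
  let D : Finset (Edge d) → Set (Edge d → ℝ) := fun s => {t | ∀ e ∈ s, t e ∈ Aᶜ}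
  have hD : ∀ s, MeasurableSet (D s) := by
    intro s
    have : D s = (s : Set (Edge d)).pi fun _ => Aᶜ := by ext t; simp [D, Set.mem_pi]
    rw [this]
    exact MeasurableSet.pi s.countable_toSet fun _ _ => hA.compl
  -- The candidate sets of `k` bad edges on a walk of length at most `K`. In the bound `(4 * 3 ^ d)
  -- ^ K`, one factor `2 ^ K` pays for the length of the walk and another for the choice of the
  -- subset.
  let I : Finset (Finset (Edge d)) := (Finset.range (K + 1)).biUnion fun n =>
    (edgeLists n x).biUnion fun l => if l.length = n then l.toFinset.powersetCard k else ∅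
  have hI : I.card ≤ (4 * 3 ^ d) ^ K := by
    have h1 : I.card ≤ (Finset.range (K + 1)).card * ((3 ^ d) ^ K * 2 ^ K) := by
      refine Finset.card_biUnion_le_card_mul _ _ _ fun n hn => ?_
      have hn' : n ≤ K := Nat.lt_succ_iff.1 (Finset.mem_range.1 hn)
      calc _ ≤ (edgeLists n x).card * 2 ^ n := by
            refine Finset.card_biUnion_le_card_mul _ _ _ fun l _ => ?_
            split_ifs with hl
            · rw [Finset.card_powersetCard]
              refine (Nat.choose_le_two_pow _ _).trans ?_
              refine Nat.pow_le_pow_right two_pos ?_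
              rw [← hl]
              exact l.toFinset_card_le
            · simp
        _ ≤ (3 ^ d) ^ n * 2 ^ n := Nat.mul_le_mul_right _ (card_edgeLists_le n x)
        _ ≤ (3 ^ d) ^ K * 2 ^ K := Nat.mul_le_mul
            (Nat.pow_le_pow_right (by positivity) hn') (Nat.pow_le_pow_right two_pos hn')
    have h2 : K + 1 ≤ 2 ^ K := Nat.lt_two_pow_self
    rw [Finset.card_range] at h1
    calc I.card ≤ 2 ^ K * ((3 ^ d) ^ K * 2 ^ K) := h1.trans (Nat.mul_le_mul_right _ h2)
      _ = (4 * 3 ^ d) ^ K := by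
        rw [show 4 * 3 ^ d = 2 * (3 ^ d * 2) by ring, mul_pow, mul_pow]
  refine ⟨⋃ s ∈ I, D s, Finset.measurableSet_biUnion _ fun s _ => hD s, ?_, ?_⟩
  · calc iidLaw (Edge d) G (⋃ s ∈ I, D s) ≤ ∑ s ∈ I, iidLaw (Edge d) G (D s) :=
          measure_biUnion_finset_le _ _
      _ ≤ ∑ s ∈ I, G Aᶜ ^ k := by
          refine Finset.sum_le_sum fun s hs => ?_
          rw [iidLaw_forall_mem s hA.compl]
          simp only [I, Finset.mem_biUnion] at hs
          obtain ⟨n, -, l, -, hs⟩ := hs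
          split_ifs at hs
          · rw [(Finset.mem_powersetCard.1 hs).2]
          · simp at hs
      _ = I.card * G Aᶜ ^ k := by rw [Finset.sum_const, nsmul_eq_mul]
      _ ≤ _ := by
          gcongr
          exact_mod_cast hI
  · intro t ht y p hp hlen
    by_contra! hk
    obtain ⟨s, hs, hcard⟩ := Finset.exists_subset_card_eq hk
    refine ht (Set.mem_biUnion (x := s) ?_ ?_)
    · simp only [I, Finset.coe_biUnion, Set.mem_iUnion]
      refine ⟨p.length, by simpa [Nat.lt_succ_iff] using hlen, edgeList p,
        edgeList_mem_edgeLists p, ?_⟩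
      rw [if_pos (length_edgeList p)]
      exact Finset.mem_powersetCard.2 ⟨hs.trans (Finset.filter_subset _ _), hcard⟩
    · intro e he
      exact (Finset.mem_filter.1 (hs he)).2

/-! ### Translation invariance. -/

/-- The translation by `w`. -/
def translation (w : Fin d → ℤ) : lattice d ≃g lattice d where
  toEquiv := Equiv.addRight w
  map_rel_iff' := by
    intro x y
    change ∑ i, |(x + w) i - (y + w) i| = 1 ↔ ∑ i, |x i - y i| = 1
    simp

@[simp]
theorem translation_apply (w x : Fin d → ℤ) : translation w x = x + w := rfl

theorem exists_map_eq (f : lattice d ≃g lattice d) {x y : Fin d → ℤ}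
    (q : (lattice d).Walk (f x) (f y)) : ∃ p : (lattice d).Walk x y, p.map f.toHom = q := by
  suffices h : ∀ {x' y' : Fin d → ℤ} (q : (lattice d).Walk x' y') (x y : Fin d → ℤ)
      (hx : f x = x') (hy : f y = y'),
      ∃ p : (lattice d).Walk x y, (p.map f.toHom).copy hx hy = q from h q x y rfl rfl
  intro x' y' q
  induction q with
  | nil =>
    intro x y hx hy
    obtain rfl : x = y := f.injective (hx.trans hy.symm)
    subst hx
    exact ⟨.nil, rfl⟩
  | @cons u v w h q ih =>
    intro x y hx hy
    obtain ⟨z, rfl⟩ := f.surjective v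
    obtain ⟨p, hp⟩ := ih z y rfl hy
    subst hx hy
    refine ⟨.cons (f.map_adj_iff.1 h) p, ?_⟩
    rw [← hp]
    rfl

theorem passageTime_map (f : lattice d ≃g lattice d) (t : Edge d → ℝ) {x y : Fin d → ℤ}
    (p : (lattice d).Walk x y) :
    passageTime t (p.map f.toHom) = passageTime (fun e => t (f.toHom.mapEdgeSet e)) p := by
  induction p with
  | nil => simp [passageTime]
  | cons h p ih =>
    simp only [passageTime, SimpleGraph.Walk.map_cons, SimpleGraph.Walk.darts_cons, List.map_cons,
      List.sum_cons] at ih ⊢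
    rw [ih]
    rfl

theorem isUniqueGeodesic_map_iff (f : lattice d ≃g lattice d) (t : Edge d → ℝ) {x y : Fin d → ℤ}
    (p : (lattice d).Walk x y) : IsUniqueGeodesic t (p.map f.toHom) ↔
      IsUniqueGeodesic (fun e => t (f.toHom.mapEdgeSet e)) p := by
  have hgeo : ∀ q : (lattice d).Walk x y, IsGeodesic t (q.map f.toHom) ↔
      IsGeodesic (fun e => t (f.toHom.mapEdgeSet e)) q := by
    intro q
    constructor
    · intro h r
      rw [← passageTime_map, ← passageTime_map]
      exact h _
    · intro h r
      obtain ⟨r, rfl⟩ := exists_map_eq f r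
      rw [passageTime_map, passageTime_map]
      exact h r
  constructor
  · rintro ⟨h1, h2⟩
    refine ⟨(hgeo p).1 h1, fun q hq => ?_⟩
    exact SimpleGraph.Walk.map_injective_of_injective f.injective _ _ (h2 _ ((hgeo q).2 hq))
  · rintro ⟨h1, h2⟩
    refine ⟨(hgeo p).2 h1, fun q hq => ?_⟩
    obtain ⟨q, rfl⟩ := exists_map_eq f q
    rw [h2 q ((hgeo q).1 hq)]

theorem geodesicVertices_map (f : lattice d ≃g lattice d) (t : Edge d → ℝ) (x y : Fin d → ℤ) :
    geodesicVertices t (f x) (f y) =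
      f '' geodesicVertices (fun e => t (f.toHom.mapEdgeSet e)) x y := by
  by_cases h : ∃ p : (lattice d).Walk x y,
      IsUniqueGeodesic (fun e => t (f.toHom.mapEdgeSet e)) p
  · obtain ⟨p, hp⟩ := h
    rw [hp.geodesicVertices_eq]
    have h2 := ((isUniqueGeodesic_map_iff f t p).2 hp).geodesicVertices_eq
    refine h2.trans ?_
    ext u
    simp
  · push Not at h
    rw [geodesicVertices_eq_empty h, Set.image_empty, geodesicVertices_eq_empty]
    intro q
    obtain ⟨q, rfl⟩ := exists_map_eq f q
    rw [isUniqueGeodesic_map_iff]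
    exact h q

theorem geodesicCount_map (f : lattice d ≃g lattice d) (S : Set (Fin d → ℤ)) (x y : Fin d → ℤ)
    (t : Edge d → ℝ) : geodesicCount S (f x) (f y) t =
      geodesicCount (f ⁻¹' S) x y fun e => t (f.toHom.mapEdgeSet e) := by
  rw [geodesicCount, geodesicCount, geodesicVertices_map, ← Set.image_inter_preimage,
    Set.ncard_image_of_injective _ f.injective]

/-- Relabelling the edges injectively preserves the product law, so moving the endpoints is the same
as moving the region back. -/
theorem integral_geodesicCount_map {G : Measure ℝ} [IsProbabilityMeasure G]
    (f : lattice d ≃g lattice d) (S : Set (Fin d → ℤ)) (x y : Fin d → ℤ) :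
    ∫ t, (geodesicCount S (f x) (f y) t : ℝ) ∂(iidLaw (Edge d) G) =
      ∫ t, (geodesicCount (f ⁻¹' S) x y t : ℝ) ∂(iidLaw (Edge d) G) := by
  have hmap : (iidLaw (Edge d) G).map (fun t e => t (f.toHom.mapEdgeSet e)) = iidLaw (Edge d) G :=
    Measure.map_infinitePi_infinitePi_of_inj (P := fun _ : Edge d => G)
      (SimpleGraph.Hom.mapEdgeSet.injective f.toHom f.injective)
  have hm := measurable_geodesicCount (f ⁻¹' S) x y
  conv_rhs => rw [← hmap]
  rw [integral_map (measurable_pi_lambda _ fun e => measurable_pi_apply _).aemeasurable]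
  · simp only [geodesicCount_map]
  · exact (measurable_from_top.comp hm).aestronglyMeasurable

theorem integrable_geodesicCount {G : Measure ℝ} [IsProbabilityMeasure G] {a b α : ℝ}
    (hG : WeightBounds G a b α) (S : Set (Fin d → ℤ)) (x y : Fin d → ℤ) :
    Integrable (fun t => (geodesicCount S x y t : ℝ)) (iidLaw (Edge d) G) := by
  have hm : Measurable fun t => (geodesicCount S x y t : ℝ) :=
    measurable_from_top.comp (measurable_geodesicCount S x y)
  refine Integrable.of_bound hm.aestronglyMeasurable (b / a * ∑ i, |(x i : ℝ) - y i| + 1) ?_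
  filter_upwards [ae_isRegular hG] with t ht
  rw [Real.norm_of_nonneg (Nat.cast_nonneg _)]
  exact geodesicCount_le hG.a_pos hG.a_lt_b.le ht S x y

/-! ### Counting vertices and edges of a path in a region. -/

theorem exists_mem_support_of_le {x y : Fin d → ℤ} (p : (lattice d).Walk x y)
    {f : (Fin d → ℤ) → ℝ} (hf : ∀ u v, (lattice d).Adj u v → f v ≤ f u + 1) {z : ℝ}
    (hx : f x < z + 1) (hy : z ≤ f y) : ∃ u ∈ p.support, z ≤ f u ∧ f u < z + 1 := by
  induction p with
  | nil => exact ⟨_, by simp, hy, hx⟩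
  | @cons u v w h p ih =>
    rcases le_or_gt z (f u) with hz | hz
    · exact ⟨u, by simp, hz, hx⟩
    · obtain ⟨c, hc, h1⟩ := ih (by linarith [hf u v h]) hy
      exact ⟨c, by simp [hc], h1⟩

/-- A walk visits each part of a slab that it crosses. -/
theorem le_ncard_slab {x y : Fin d → ℤ} (p : (lattice d).Walk x y)
    {f : (Fin d → ℤ) → ℝ} (hf : ∀ u v, (lattice d).Adj u v → f v ≤ f u + 1) {z z' : ℝ}
    (hx : f x ≤ z) (hy : z' ≤ f y) :
    z' - z - 1 ≤ ({u | u ∈ p.support} ∩ {u | z ≤ f u ∧ f u ≤ z'}).ncard := by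
  -- One visited vertex per unit layer: `f` rises by at most one per step, so no layer is jumped
  -- over.
  have h : ∀ j : ℕ, j < ⌊z' - z⌋₊ → ∃ u ∈ p.support, z + j ≤ f u ∧ f u < z + j + 1 := by
    intro j hj
    have hj1 : (j : ℝ) + 1 ≤ z' - z := by
      have : (j + 1 : ℕ) ≤ ⌊z' - z⌋₊ := hj
      rw [Nat.le_floor_iff' (by simp)] at this
      exact_mod_cast this
    refine exists_mem_support_of_le p hf ?_ ?_
    · have : (0 : ℝ) ≤ j := Nat.cast_nonneg j
      linarith
    · linarith
  choose! g hg1 hg2 hg3 using h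
  have hinj : Set.InjOn g (Finset.range ⌊z' - z⌋₊) := by
    intro i hi j hj hij
    rw [Finset.mem_coe, Finset.mem_range] at hi hj
    have h1 := hg2 i hi
    have h2 := hg3 i hi
    have h3 := hg2 j hj
    have h4 := hg3 j hj
    rw [hij] at h1 h2
    have h5 : (i : ℝ) < j + 1 := by linarith
    have h6 : (j : ℝ) < i + 1 := by linarith
    have h5' : i < j + 1 := by exact_mod_cast h5
    have h6' : j < i + 1 := by exact_mod_cast h6
    lia
  have hle : ⌊z' - z⌋₊ ≤ ({u | u ∈ p.support} ∩ {u | z ≤ f u ∧ f u ≤ z'}).ncard := by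
    have h1 := hinj.ncard_image
    rw [Set.ncard_coe_finset, Finset.card_range] at h1
    rw [← h1]
    refine Set.ncard_le_ncard ?_ ((List.finite_toSet _).subset Set.inter_subset_left)
    rintro _ ⟨j, hj, rfl⟩
    rw [Finset.mem_coe, Finset.mem_range] at hj
    have hj1 : (j : ℝ) + 1 ≤ z' - z := by
      have : (j + 1 : ℕ) ≤ ⌊z' - z⌋₊ := hj
      rw [Nat.le_floor_iff' (by simp)] at this
      exact_mod_cast this
    have h0 : (0 : ℝ) ≤ j := Nat.cast_nonneg j
    exact ⟨hg1 j hj, by linarith [hg2 j hj], by linarith [hg3 j hj]⟩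
  have h2 := Nat.lt_floor_add_one (z' - z)
  have h3 : (⌊z' - z⌋₊ : ℝ) ≤ ({u | u ∈ p.support} ∩ {u | z ≤ f u ∧ f u ≤ z'}).ncard := by
    exact_mod_cast hle
  linarith

/-- The edges having an endpoint in `S`. -/
def touching (S : Set (Fin d → ℤ)) : Set (Edge d) := {e | ∃ u ∈ S, u ∈ (e : Sym2 (Fin d → ℤ))}

-- Every vertex but the last is followed by its own edge; the last accounts for the `+ 1`.
open Classical in
theorem ncard_inter_le_card_touching {x y : Fin d → ℤ} {p : (lattice d).Walk x y} (hp : p.IsPath)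
    (S : Set (Fin d → ℤ)) : ({u | u ∈ p.support} ∩ S).ncard ≤
      ((edgeFinset p).filter (· ∈ touching S)).card + 1 := by
  induction p with
  | @nil u =>
    refine (Set.ncard_le_ncard (t := {u}) ?_ (Set.finite_singleton u)).trans ?_
    · rintro z ⟨hz, -⟩
      simpa using hz
    · simp
  | @cons u v w h p ih =>
    have hp' := (SimpleGraph.Walk.cons_isPath_iff h p).1 hp
    have hE : edgeFinset (SimpleGraph.Walk.cons h p) = insert ⟨s(u, v), h⟩ (edgeFinset p) := by
      ext e
      simp [edgeFinset, edgeList, SimpleGraph.Dart.edge]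
    have hnot : (⟨s(u, v), h⟩ : Edge d) ∉ edgeFinset p := by
      rw [mem_edgeFinset, mem_edgeList]
      exact fun hmem => hp'.2 (p.fst_mem_support_of_mem_edges hmem)
    have hfin : ({z | z ∈ p.support} ∩ S).Finite :=
      (List.finite_toSet _).subset Set.inter_subset_left
    by_cases hu : u ∈ S
    · have hsub : {z | z ∈ (SimpleGraph.Walk.cons h p).support} ∩ S ⊆
          insert u ({z | z ∈ p.support} ∩ S) := by
        rintro z ⟨hz, hzS⟩
        rw [Set.mem_ofPred_eq, SimpleGraph.Walk.support_cons, List.mem_cons] at hz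
        rcases hz with rfl | hz
        · exact Set.mem_insert _ _
        · exact Set.mem_insert_of_mem _ ⟨hz, hzS⟩
      have h1 := (Set.ncard_le_ncard hsub (hfin.insert u)).trans (Set.ncard_insert_le _ _)
      have h2 : (⟨s(u, v), h⟩ : Edge d) ∈ touching S := ⟨u, hu, by simp⟩
      rw [hE, Finset.filter_insert, if_pos h2, Finset.card_insert_of_notMem (by simp [hnot])]
      have := ih hp'.1
      lia
    · have hsub : {z | z ∈ (SimpleGraph.Walk.cons h p).support} ∩ S ⊆
          {z | z ∈ p.support} ∩ S := by
        rintro z ⟨hz, hzS⟩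
        rw [Set.mem_ofPred_eq, SimpleGraph.Walk.support_cons, List.mem_cons] at hz
        rcases hz with rfl | hz
        · exact absurd hzS hu
        · exact ⟨hz, hzS⟩
      refine (Set.ncard_le_ncard hsub hfin).trans ((ih hp'.1).trans ?_)
      gcongr
      rw [hE]
      exact Finset.subset_insert _ _

open Classical in
theorem card_touching_le {x y : Fin d → ℤ} {p : (lattice d).Walk x y} (hp : p.IsPath)
    (S : Set (Fin d → ℤ)) : ((edgeFinset p).filter (· ∈ touching S)).card ≤
      2 * ({u | u ∈ p.support} ∩ S).ncard := by
  -- The extra term for the starting vertex makes the induction close: it reserves one of the two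
  -- edges counted at `x` for the edge prepended next.
  suffices h : ((edgeFinset p).filter (· ∈ touching S)).card + (if x ∈ S then 1 else 0) ≤
      2 * ({u | u ∈ p.support} ∩ S).ncard from (Nat.le_add_right _ _).trans h
  induction p with
  | @nil u =>
    by_cases hu : u ∈ S
    · have : {z | z ∈ (SimpleGraph.Walk.nil : (lattice d).Walk u u).support} ∩ S = {u} := by
        ext z
        simp only [SimpleGraph.Walk.support_nil, List.mem_singleton, Set.mem_inter_iff,
          Set.mem_ofPred_eq, Set.mem_singleton_iff]
        exact ⟨fun h => h.1, fun h => ⟨h, h ▸ hu⟩⟩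
      rw [this]
      simp [hu, edgeFinset, edgeList]
    · simp [hu, edgeFinset, edgeList]
  | @cons u v w h p ih =>
    have hp' := (SimpleGraph.Walk.cons_isPath_iff h p).1 hp
    have hE : edgeFinset (SimpleGraph.Walk.cons h p) = insert ⟨s(u, v), h⟩ (edgeFinset p) := by
      ext e
      simp [edgeFinset, edgeList, SimpleGraph.Dart.edge]
    have hfin : ({z | z ∈ p.support} ∩ S).Finite :=
      (List.finite_toSet _).subset Set.inter_subset_left
    have hfin' : ({z | z ∈ (SimpleGraph.Walk.cons h p).support} ∩ S).Finite :=
      (List.finite_toSet _).subset Set.inter_subset_left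
    have h1 := ih hp'.1
    have hT : (⟨s(u, v), h⟩ : Edge d) ∈ touching S ↔ u ∈ S ∨ v ∈ S := by
      simp [touching, and_or_left, exists_or]
    have hcard : ((edgeFinset (SimpleGraph.Walk.cons h p)).filter (· ∈ touching S)).card ≤
        ((edgeFinset p).filter (· ∈ touching S)).card + (if u ∈ S ∨ v ∈ S then 1 else 0) := by
      rw [hE, Finset.filter_insert]
      simp only [hT]
      split_ifs
      · exact Finset.card_insert_le _ _
      · simp
    have hsupp : ({z | z ∈ p.support} ∩ S).ncard + (if u ∈ S then 1 else 0) ≤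
        ({z | z ∈ (SimpleGraph.Walk.cons h p).support} ∩ S).ncard := by
      have hsub : {z | z ∈ p.support} ∩ S ⊆
          {z | z ∈ (SimpleGraph.Walk.cons h p).support} ∩ S := by
        rintro z ⟨hz, hzS⟩
        exact ⟨by simp [show z ∈ p.support from hz], hzS⟩
      split_ifs with hu
      · rw [← Set.ncard_insert_of_notMem (a := u) (fun hmem => hp'.2 hmem.1) hfin]
        refine Set.ncard_le_ncard (Set.insert_subset ?_ hsub) hfin'
        exact ⟨by simp, hu⟩
      · exact Set.ncard_le_ncard hsub hfin'
    by_cases hu : u ∈ S <;> by_cases hv : v ∈ S <;>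
      simp only [hu, hv, or_true, or_false, if_true, if_false] at hcard hsupp h1 ⊢ <;> lia


/-! ### Deterministic comparison of geodesics. -/

theorem exists_append_of_le_length {x y : Fin d → ℤ} (p : (lattice d).Walk x y) {n : ℕ}
    (hn : n ≤ p.length) : ∃ (z : Fin d → ℤ) (q : (lattice d).Walk x z) (r : (lattice d).Walk z y),
      p = q.append r ∧ q.length = n := by
  induction p generalizing n with
  | nil => exact ⟨_, .nil, .nil, rfl, (Nat.le_zero.1 hn).symm⟩
  | cons h p ih =>
    cases n with
    | zero => exact ⟨_, .nil, .cons h p, rfl, rfl⟩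
    | succ n =>
      obtain ⟨z, q, r, hqr, hq⟩ := ih (by simpa using hn)
      exact ⟨z, .cons h q, r, by simp [hqr], by simp [hq]⟩

theorem edgeFinset_append {x y z : Fin d → ℤ} (p : (lattice d).Walk x y)
    (q : (lattice d).Walk y z) : edgeFinset (p.append q) = edgeFinset p ∪ edgeFinset q := by
  classical
  ext e
  simp [mem_edgeFinset, mem_edgeList]

theorem mul_length_le_of_isGeodesic {a b : ℝ} (hb : 0 ≤ b) {t : Edge d → ℝ}
    (hta : ∀ e, a ≤ t e) (htb : ∀ e, t e ≤ b) {x y z : Fin d → ℤ} {q : (lattice d).Walk x z}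
    {r : (lattice d).Walk z y} (h : IsGeodesic t (q.append r)) :
    a * q.length ≤ b * ∑ i, |(x i : ℝ) - z i| := by
  refine (le_passageTime hta q).trans (IsGeodesic.passageTime_le hb htb fun q' => ?_)
  have := h (q'.append r)
  rw [passageTime_append, passageTime_append] at this
  linarith

/-- If a geodesic from the origin is long, then it touches a set close to the origin only at its
beginning. -/
theorem mem_edgeFinset_of_mem_touching {a b : ℝ} (hb : 0 ≤ b) {t : Edge d → ℝ} (ha : 0 < a)
    (hta : ∀ e, a ≤ t e) (htb : ∀ e, t e ≤ b) {y z : Fin d → ℤ} {q : (lattice d).Walk 0 z}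
    {r : (lattice d).Walk z y} (h : IsGeodesic t (q.append r)) {S : Set (Fin d → ℤ)}
    (hS : ∀ u ∈ S, b * ∑ i, |(u i : ℝ)| < a * q.length) {e : Edge d} (he : e ∈ touching S)
    (hmem : e ∈ edgeFinset (q.append r)) : e ∈ edgeFinset q := by
  classical
  rw [edgeFinset_append, Finset.mem_union] at hmem
  refine hmem.resolve_right fun her => ?_
  obtain ⟨u, huS, hu⟩ := he
  rw [mem_edgeFinset, mem_edgeList] at her
  have hur : u ∈ r.support := r.mem_support_of_mem_edges her hu
  -- If `e` were used after `q`, the geodesic would reach `u ∈ S` after at least `q.length` edges,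
  -- too late for a point so close to the origin.
  rw [← r.take_spec hur, SimpleGraph.Walk.append_assoc] at h
  have h1 := mul_length_le_of_isGeodesic hb hta htb h
  have h2 := hS u huS
  simp only [Pi.zero_apply, Int.cast_zero, zero_sub, abs_neg, SimpleGraph.Walk.length_append,
    Nat.cast_add, mul_add] at h1
  have h3 : 0 ≤ a * (r.takeUntil u hur).length := by positivity
  linarith

theorem IsGeodesic.passageTime_le_of_translate {b : ℝ} {t : Edge d → ℝ} (hb : 0 ≤ b)
    (htb : ∀ e, t e ≤ b) {x y x' y' : Fin d → ℤ} {p : (lattice d).Walk x y}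
    {q : (lattice d).Walk x' y'} (hp : IsGeodesic t p) :
    passageTime t p ≤ passageTime t q +
      b * (∑ i, |(x i : ℝ) - x' i| + ∑ i, |(y' i : ℝ) - y i|) := by
  obtain ⟨r, hr⟩ := exists_walk_length_le x x'
  obtain ⟨s, hs⟩ := exists_walk_length_le y' y
  have hr' : (r.length : ℝ) ≤ ∑ i, |(x i : ℝ) - x' i| := by exact_mod_cast hr
  have hs' : (s.length : ℝ) ≤ ∑ i, |(y' i : ℝ) - y i| := by exact_mod_cast hs
  have h1 := hp (r.append (q.append s))
  rw [passageTime_append, passageTime_append] at h1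
  have h2 := (FPP.passageTime_le htb r).trans (mul_le_mul_of_nonneg_left hr' hb)
  have h3 := (FPP.passageTime_le htb s).trans (mul_le_mul_of_nonneg_left hs' hb)
  linarith

open Classical in
/-- The edges in `touching S` of a geodesic from the origin mostly have weights in `A`. -/
theorem ncard_le_card_filter_add {a b : ℝ} (hb : 0 ≤ b) {t : Edge d → ℝ} (ha : 0 < a)
    (hta : ∀ e, a ≤ t e) (htb : ∀ e, t e ≤ b) {S : Set (Fin d → ℤ)} {K k : ℕ} {A : Set ℝ}
    (hS : ∀ u ∈ S, b * ∑ i, |(u i : ℝ)| < a * K)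
    (hfew : ∀ (y : Fin d → ℤ) (p : (lattice d).Walk 0 y), p.IsPath → p.length ≤ K →
        ((edgeFinset p).filter fun e => t e ∉ A).card < k)
    {y : Fin d → ℤ} {p : (lattice d).Walk 0 y} (hp : IsGeodesic t p) :
    ({u | u ∈ p.support} ∩ S).ncard ≤
      ((edgeFinset p).filter fun e => e ∈ touching S ∧ t e ∈ A).card + k := by
  have hpath := hp.isPath ha hta
  have h1 := ncard_inter_le_card_touching hpath S
  have h2 : ((edgeFinset p).filter fun e => e ∈ touching S ∧ t e ∉ A).card < k := by
    -- The bound on exceptional edges covers only paths of length at most `K`; a longer geodesic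
    -- touches `S` only within its first `K` edges.
    rcases le_or_gt p.length K with hK | hK
    · refine lt_of_le_of_lt (Finset.card_le_card ?_) (hfew y p hpath hK)
      exact Finset.monotone_filter_right _ fun e _ he => he.2
    · obtain ⟨z, q, r, rfl, hq⟩ := exists_append_of_le_length p hK.le
      refine lt_of_le_of_lt (Finset.card_le_card ?_) (hfew z q hpath.of_append_left hq.le)
      intro e he
      rw [Finset.mem_filter] at he ⊢
      exact ⟨mem_edgeFinset_of_mem_touching hb ha hta htb hp (by rwa [hq]) he.2.1 he.1, he.2.2⟩
  have h3 : ((edgeFinset p).filter (· ∈ touching S)).card =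
      ((edgeFinset p).filter fun e => e ∈ touching S ∧ t e ∈ A).card +
      ((edgeFinset p).filter fun e => e ∈ touching S ∧ t e ∉ A).card := by
    rw [← Finset.card_filter_add_card_filter_not (s := (edgeFinset p).filter (· ∈ touching S))
      (fun e => t e ∈ A), Finset.filter_filter, Finset.filter_filter]
  lia

/-- If the geodesic from `0` to `v` has many vertices in `S` while the geodesic from `w` to `v + w`
has few, then the effect of increasing the weights near `S` is bounded by the cost of moving
from one pair of endpoints to the other. -/
theorem gain_le_of_isGeodesic {a b κ τ η N N' : ℝ} (ha : 0 < a) (hb : 0 ≤ b) (hκ : 0 ≤ κ)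
    (hτ : 0 ≤ τ) (hη : 0 ≤ η) {t x : Edge d → ℝ} (ht : IsRegular a b t) (hx : IsRegular a b x)
    {S : Set (Fin d → ℤ)} {A : Set ℝ} {K k : ℕ}
    (hS : ∀ u ∈ S, b * ∑ i, |(u i : ℝ)| < a * K)
    (hfew : ∀ (y : Fin d → ℤ) (p : (lattice d).Walk 0 y), p.IsPath → p.length ≤ K →
        open Classical in ((edgeFinset p).filter fun e => x e ∉ A).card < k)
    (htx : ∀ e, t e ≤ x e) (hlow : ∀ e ∈ touching S, x e ∈ A → κ * τ ≤ x e - t e)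
    (hup : ∀ e ∈ touching S, x e - t e ≤ η) (hoff : ∀ e ∉ touching S, x e = t e)
    {v w : Fin d → ℤ} (hN : N ≤ geodesicCount S 0 v x)
    (hN' : geodesicCount S w (v + w) t ≤ N') :
    κ * τ * (N - k) ≤ η * (2 * N') + 4 * b * ∑ i, |(w i : ℝ)| := by
  classical
  obtain ⟨p, hp, hpp⟩ := hx.exists_isUniqueGeodesic ha 0 v
  obtain ⟨q, hq, hqp⟩ := ht.exists_isUniqueGeodesic ha w (v + w)
  obtain ⟨p', hp', -⟩ := ht.exists_isUniqueGeodesic ha 0 v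
  obtain ⟨q', hq', -⟩ := hx.exists_isUniqueGeodesic ha w (v + w)
  rw [geodesicCount, hp.geodesicVertices_eq] at hN
  rw [geodesicCount, hq.geodesicVertices_eq] at hN'
  have hcount := ncard_le_card_filter_add hb ha hx.le hx.ge hS hfew hp.1
  have hgain : κ * τ * ((edgeFinset p).filter fun e => e ∈ touching S ∧ x e ∈ A).card ≤
      passageTime x p - passageTime t p := by
    rw [passageTime_eq_sum hpp, passageTime_eq_sum hpp, ← Finset.sum_sub_distrib, mul_comm,
      ← nsmul_eq_mul, ← Finset.sum_const, Finset.sum_filter]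
    refine Finset.sum_le_sum fun e _ => ?_
    split_ifs with he
    · exact hlow e he.1 he.2
    · exact sub_nonneg.2 (htx e)
  have hloss : passageTime x q - passageTime t q ≤
      η * ((edgeFinset q).filter (· ∈ touching S)).card := by
    rw [passageTime_eq_sum hqp, passageTime_eq_sum hqp, ← Finset.sum_sub_distrib, mul_comm,
      ← nsmul_eq_mul, ← Finset.sum_const, Finset.sum_filter]
    refine Finset.sum_le_sum fun e _ => ?_
    split_ifs with he
    · exact hup e he
    · rw [hoff e he, sub_self]
  have hT := card_touching_le hqp S
  -- The chain is `T_x(p) ≤ T_x(q') + 2b|w|₁ ≤ T_x(q) + 2b|w|₁` in the environment `x`, and `T_t(q)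
  -- ≤ T_t(p') + 2b|w|₁ ≤ T_t(p) + 2b|w|₁` in `t`. Together with `hgain` and `hloss` it bounds the
  -- gain on `p` by the loss on `q`.
  have h1 := hp.1.passageTime_le_of_translate hb hx.ge (q := q')
  have h2 := hq.1.passageTime_le_of_translate hb ht.ge (q := p')
  have h3 := hp'.1 p
  have h4 := hq'.1 q
  have e1 : ∑ i, |((0 : Fin d → ℤ) i : ℝ) - w i| = ∑ i, |(w i : ℝ)| := by simp
  have e2 : ∑ i, |((v + w) i : ℝ) - v i| = ∑ i, |(w i : ℝ)| := by simp
  have e3 : ∑ i, |(w i : ℝ) - (0 : Fin d → ℤ) i| = ∑ i, |(w i : ℝ)| := by simp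
  have e4 : ∑ i, |(v i : ℝ) - (v + w) i| = ∑ i, |(w i : ℝ)| := by simp
  rw [e1, e2] at h1
  rw [e3, e4] at h2
  have hcount' : N - k ≤ ((edgeFinset p).filter fun e => e ∈ touching S ∧ x e ∈ A).card := by
    have : (({u | u ∈ p.support} ∩ S).ncard : ℝ) ≤
        ((edgeFinset p).filter fun e => e ∈ touching S ∧ x e ∈ A).card + k := by
      exact_mod_cast hcount
    linarith
  have hT' : (((edgeFinset q).filter (· ∈ touching S)).card : ℝ) ≤ 2 * N' := by
    have : (((edgeFinset q).filter (· ∈ touching S)).card : ℝ) ≤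
        2 * ({u | u ∈ q.support} ∩ S).ncard := by
      exact_mod_cast hT
    linarith
  have h5 := mul_le_mul_of_nonneg_left hcount' (mul_nonneg hκ hτ)
  have h6 := mul_le_mul_of_nonneg_left hT' hη
  linarith

/-! ### The probabilistic perturbation estimate. -/

/-- Under the tilted law, `x` is close to i.i.d. in total variation, while `transformOn R φ x` is
exactly i.i.d. The two events on vertex counts therefore occur together for some regular pair, to
which the deterministic comparison applies. -/
theorem perturbation_bound {G : Measure ℝ} [IsProbabilityMeasure G] {a b α : ℝ}
    (hG : WeightBounds G a b α) {κ : ℝ} (hκ : 0 ≤ κ) {A : Set ℝ} (hA : MeasurableSet A)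
    (hAr : A ⊆ robustWeights G a b κ) (v w : Fin d → ℤ) {S : Set (Fin d → ℤ)}
    {R : Finset (Edge d)} (hR : ∀ e, e ∈ R ↔ e ∈ touching S) {K k : ℕ}
    (hS : ∀ u ∈ S, b * ∑ i, |(u i : ℝ)| < a * K)
    (hB : (4 * 3 ^ d) ^ K * G Aᶜ ^ k ≤ ENNReal.ofReal (1 / 20)) {τ : ℝ} (h0 : 0 ≤ τ)
    (h1 : τ < 1) (hτ : (1 + τ ^ 2) ^ R.card - 1 ≤ (1 / 20) ^ 2) {N N' : ℝ}
    (hN : 1 / 3 ≤ (iidLaw (Edge d) G).real {t | N ≤ geodesicCount S 0 v t})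
    (hN' : 9 / 10 ≤ (iidLaw (Edge d) G).real {t | geodesicCount S w (v + w) t ≤ N'}) :
    κ * τ * (N - k) ≤ τ / α * (2 * N') + 4 * b * ∑ i, |(w i : ℝ)| := by
  obtain ⟨φ, L, hφ⟩ := hG.exists_isTilting h0 h1
  obtain ⟨B, hBm, hBle, hBfew⟩ := exists_few_exceptional (G := G) hA (0 : Fin d → ℤ) K k
  have hprob := hφ.isProbabilityMeasure R (ι := Edge d)
  have hm : Measurable fun t => (geodesicCount S 0 v t : ℝ) :=
    measurable_from_top.comp (measurable_geodesicCount S 0 v)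
  have hm' : Measurable fun t => (geodesicCount S w (v + w) t : ℝ) :=
    measurable_from_top.comp (measurable_geodesicCount S w (v + w))
  have hE₁ : MeasurableSet {t : Edge d → ℝ | N ≤ geodesicCount S 0 v t} :=
    measurableSet_le measurable_const hm
  have hE₂ : MeasurableSet {t : Edge d → ℝ | (geodesicCount S w (v + w) t : ℝ) ≤ N'} :=
    measurableSet_le hm' measurable_const
  have hΦ := measurable_transformOn R hφ.measurable_map
  have hBr : (iidLaw (Edge d) G).real B ≤ 1 / 20 :=
    ENNReal.toReal_le_of_le_ofReal (by norm_num) (hBle.trans hB)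
  have hreg₁ : ∀ᵐ x ∂(tiltedLaw G R L), IsRegular a b x :=
    (withDensity_absolutelyContinuous _ _).ae_le (ae_isRegular hG)
  have hreg₂ : ∀ᵐ x ∂(tiltedLaw G R L), IsRegular a b (transformOn R φ x) := by
    refine ae_of_ae_map hΦ.aemeasurable ?_
    rw [hφ.tiltedLaw_map]
    exact ae_isRegular hG
  -- `1/3 - 1/20 - 1/20 = 7/30`, losing once for the exceptional set `B` and once for the change of
  -- measure; `7/30 + 9/10 > 1` then forces an intersection of positive measure.
  have hP₁ : 7 / 30 ≤ (tiltedLaw G R L).real ({t | N ≤ geodesicCount S 0 v t} \ B) := by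
    have h2 := hφ.measureReal_le R (δ := 1 / 20) (by norm_num) hτ (hE₁.diff hBm)
    have h3 : (iidLaw (Edge d) G).real {t | N ≤ geodesicCount S 0 v t} ≤
        (iidLaw (Edge d) G).real ({t | N ≤ geodesicCount S 0 v t} \ B) +
        (iidLaw (Edge d) G).real B := by
      refine (measureReal_mono ?_).trans (measureReal_union_le _ _)
      rw [Set.sdiff_union_self]
      exact Set.subset_union_left
    linarith
  have hP₂ : 9 / 10 ≤ (tiltedLaw G R L).real
      (transformOn R φ ⁻¹' {t | (geodesicCount S w (v + w) t : ℝ) ≤ N'}) := by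
    rwa [measureReal_def, ← Measure.map_apply hΦ hE₂, hφ.tiltedLaw_map, ← measureReal_def]
  have hpos : 0 < (tiltedLaw G R L).real (({t | N ≤ geodesicCount S 0 v t} \ B) ∩
      (transformOn R φ ⁻¹' {t | (geodesicCount S w (v + w) t : ℝ) ≤ N'})) := by
    have h2 := measureReal_union_add_inter (μ := tiltedLaw G R L)
      (s := {t | N ≤ geodesicCount S 0 v t} \ B) (hΦ hE₂)
    have h3 := measureReal_le_one (μ := tiltedLaw G R L)
      (s := ({t | N ≤ geodesicCount S 0 v t} \ B) ∪
      (transformOn R φ ⁻¹' {t | (geodesicCount S w (v + w) t : ℝ) ≤ N'}))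
    linarith
  obtain ⟨x, ⟨⟨hx₁, hxB⟩, hx₂⟩, hxr, htr⟩ : ∃ x ∈ ({t | N ≤ geodesicCount S 0 v t} \ B) ∩
      (transformOn R φ ⁻¹' {t | (geodesicCount S w (v + w) t : ℝ) ≤ N'}),
      IsRegular a b x ∧ IsRegular a b (transformOn R φ x) := by
    by_contra! hcon
    refine hpos.ne' ?_
    rw [measureReal_def, measure_eq_zero_iff_ae_notMem.2, ENNReal.toReal_zero]
    filter_upwards [hreg₁, hreg₂] with x hx1 hx2 hmem
    exact hcon x hmem hx1 hx2
  have hIcc : ∀ e, x e ∈ Set.Icc a b := fun e => ⟨hxr.le e, hxr.ge e⟩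
  refine gain_le_of_isGeodesic (t := transformOn R φ x) hG.a_pos (hG.a_pos.trans hG.a_lt_b).le hκ
    h0 (div_nonneg h0 hG.α_pos.le) htr hxr hS (hBfew x hxB) ?_ ?_ ?_ ?_ hx₁ hx₂
  · intro e
    by_cases he : e ∈ R <;> simp only [transformOn, he, if_true, if_false, le_refl]
    exact hφ.map_le hG h0 (hIcc e)
  · intro e he hxe
    rw [← hR] at he
    simp only [transformOn, he, if_true]
    exact (hAr hxe).2 _ (hφ.map_le hG h0 (hIcc e)) τ h0 (hφ.cdf_eq _)
  · intro e he
    rw [← hR] at he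
    simp only [transformOn, he, if_true]
    exact hφ.sub_map_le hG h0 (hIcc e)
  · intro e he
    rw [← hR] at he
    simp only [transformOn, he, if_false]


/-! ### Euclidean geometry of slabs and cylinders. -/

theorem toEuclid_add (x y : Fin d → ℤ) : toEuclid (x + y) = toEuclid x + toEuclid y := by
  ext i; simp [toEuclid]

theorem toEuclid_sub (x y : Fin d → ℤ) : toEuclid (x - y) = toEuclid x - toEuclid y := by
  ext i; simp [toEuclid]

@[simp]
theorem toEuclid_zero : toEuclid (0 : Fin d → ℤ) = 0 := by
  ext i; simp [toEuclid]

theorem sum_abs_le (u : Fin d → ℤ) : ∑ i, |(u i : ℝ)| ≤ d * ‖toEuclid u‖ := by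
  have h : ∀ i ∈ Finset.univ, |(u i : ℝ)| ≤ ‖toEuclid u‖ := fun i _ =>
    PiLp.norm_apply_le (toEuclid u) i
  simpa using Finset.sum_le_card_nsmul _ _ _ h

theorem norm_toEuclid_le_one_of_adj {x y : Fin d → ℤ} (h : (lattice d).Adj x y) :
    ‖toEuclid (y - x)‖ ≤ 1 := by
  have h1 : ∑ i, |x i - y i| = 1 := h
  have h2 : ∑ i, ((y i - x i : ℤ) : ℝ) ^ 2 ≤ 1 := by
    have : ∑ i, (y i - x i) ^ 2 ≤ ∑ i, |x i - y i| := by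
      refine Finset.sum_le_sum fun i _ => ?_
      have h3 : |x i - y i| ≤ 1 := h1 ▸ Finset.single_le_sum (f := fun i => |x i - y i|)
        (fun _ _ => abs_nonneg _) (Finset.mem_univ i)
      rw [← sq_abs, abs_sub_comm, sq]
      exact mul_le_of_le_one_left (abs_nonneg _) h3
    rw [h1] at this
    exact_mod_cast this
  rw [EuclideanSpace.norm_eq]
  refine Real.sqrt_le_one.2 ?_
  simpa [toEuclid] using h2

/-- The coordinate of `u` in the direction of `v`. -/
noncomputable def height (v u : Fin d → ℤ) : ℝ :=
  inner ℝ (toEuclid u) (‖toEuclid v‖⁻¹ • toEuclid v)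

theorem height_add (v x y : Fin d → ℤ) : height v (x + y) = height v x + height v y := by
  rw [height, toEuclid_add, inner_add_left]
  rfl

theorem norm_direction_le (v : Fin d → ℤ) : ‖‖toEuclid v‖⁻¹ • toEuclid v‖ ≤ 1 := by
  rw [norm_smul, norm_inv, norm_norm]
  exact inv_mul_le_one

theorem abs_height_le (v u : Fin d → ℤ) : |height v u| ≤ ‖toEuclid u‖ := by
  refine (abs_real_inner_le_norm _ _).trans ?_
  exact mul_le_of_le_one_right (norm_nonneg _) (norm_direction_le v)

@[simp]
theorem height_zero (v : Fin d → ℤ) : height v 0 = 0 := by simp [height]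

theorem height_self (v : Fin d → ℤ) : height v v = ‖toEuclid v‖ := by
  rw [height, inner_smul_right, real_inner_self_eq_norm_sq, sq]
  by_cases h : ‖toEuclid v‖ = 0
  · simp [h]
  · field_simp

theorem height_le_of_adj (v x y : Fin d → ℤ) (h : (lattice d).Adj x y) :
    height v y ≤ height v x + 1 := by
  have h1 := height_add v x (y - x)
  rw [add_sub_cancel] at h1
  have h2 := (abs_height_le v (y - x)).trans (norm_toEuclid_le_one_of_adj h)
  linarith [le_abs_self (height v (y - x))]

/-- The axis point witnessing membership need not be the orthogonal projection, but the two differ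
by at most `r`; hence `2 * r`. -/
theorem norm_sub_height_smul_le {v u : Fin d → ℤ} (hv : 0 < ‖toEuclid v‖) {r : ℝ}
    (hu : toEuclid u ∈ cyl (toEuclid v) r) :
    ‖toEuclid u - height v u • (‖toEuclid v‖⁻¹ • toEuclid v)‖ ≤ 2 * r := by
  obtain ⟨s, hs⟩ := hu
  obtain ⟨e, he⟩ : ∃ e, e = ‖toEuclid v‖⁻¹ • toEuclid v := ⟨_, rfl⟩
  have hve : s • toEuclid v = (s * ‖toEuclid v‖) • e := by
    rw [he, smul_smul, mul_assoc, mul_inv_cancel₀ hv.ne', mul_one]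
  have hee : inner ℝ e e = (1 : ℝ) := by
    rw [real_inner_self_eq_norm_sq, he, norm_smul, norm_inv, norm_norm, inv_mul_cancel₀ hv.ne',
      one_pow]
  have hle : ‖e‖ ≤ 1 := he ▸ norm_direction_le v
  have h1 : height v u - s * ‖toEuclid v‖ = inner ℝ (toEuclid u - s • toEuclid v) e := by
    rw [inner_sub_left, hve, inner_smul_left, hee]
    simp [height, he]
  have h2 : |height v u - s * ‖toEuclid v‖| ≤ r := by
    rw [h1]
    refine (abs_real_inner_le_norm _ _).trans ?_
    exact (mul_le_of_le_one_right (norm_nonneg _) hle).trans hs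
  have h3 : toEuclid u - height v u • e =
      (toEuclid u - s • toEuclid v) - (height v u - s * ‖toEuclid v‖) • e := by
    rw [hve, sub_smul]
    abel
  rw [← he]
  rw [h3]
  refine (norm_sub_le _ _).trans ?_
  rw [norm_smul, Real.norm_eq_abs]
  have := mul_le_of_le_one_right (abs_nonneg (height v u - s * ‖toEuclid v‖)) hle
  linarith

theorem norm_toEuclid_le {v u : Fin d → ℤ} (hv : 0 < ‖toEuclid v‖) {r : ℝ}
    (hu : toEuclid u ∈ cyl (toEuclid v) r) : ‖toEuclid u‖ ≤ |height v u| + 2 * r := by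
  have h1 := norm_sub_height_smul_le hv hu
  have h2 : ‖height v u • (‖toEuclid v‖⁻¹ • toEuclid v)‖ ≤ |height v u| := by
    rw [norm_smul, Real.norm_eq_abs]
    exact mul_le_of_le_one_right (abs_nonneg _) (norm_direction_le v)
  have h3 := norm_le_norm_add_norm_sub' (toEuclid u)
    (height v u • (‖toEuclid v‖⁻¹ • toEuclid v))
  linarith

/-- The number of lattice points in a portion of a cylinder. -/
theorem exists_finset_cyl {v : Fin d → ℤ} (hv : 0 < ‖toEuclid v‖) (hd : 1 ≤ d) {ℓ r : ℝ}
    (hr : 1 ≤ r) (hrℓ : r ≤ ℓ) : ∃ Q : Finset (Fin d → ℤ),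
      (∀ u, 0 ≤ height v u → height v u ≤ ℓ → toEuclid u ∈ cyl (toEuclid v) r → u ∈ Q) ∧
      (Q.card : ℝ) ≤ 2 * 7 ^ d * (ℓ * r ^ (d - 1)) := by
  classical
  have hr0 : 0 < r := by linarith
  let e := ‖toEuclid v‖⁻¹ • toEuclid v
  -- Cubes of side `6r` centred at the points `k r e` of the axis cover the piece of cylinder; each
  -- has at most `(6r + 1)^d ≤ (7r)^d` lattice points.
  let Q₀ : ℕ → Finset (Fin d → ℤ) := fun k => Fintype.piFinset fun i =>
    Finset.Icc ⌈k * r * e i - 3 * r⌉ ⌊k * r * e i + 3 * r⌋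
  have hQ₀ : ∀ k, ((Q₀ k).card : ℝ) ≤ (7 * r) ^ d := by
    intro k
    rw [Fintype.card_piFinset, Nat.cast_prod]
    have : ∀ i ∈ Finset.univ,
        ((Finset.Icc ⌈k * r * e i - 3 * r⌉ ⌊k * r * e i + 3 * r⌋).card : ℝ) ≤ 7 * r := by
      intro i _
      rw [Int.card_Icc]
      have h1 := Int.floor_le (k * r * e i + 3 * r)
      have h2 := Int.le_ceil (k * r * e i - 3 * r)
      have h3 : (((⌊k * r * e i + 3 * r⌋ + 1 - ⌈k * r * e i - 3 * r⌉).toNat : ℤ) : ℝ) ≤ 7 * r := by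
        rw [Int.toNat_eq_max, Int.cast_max]
        refine max_le ?_ (by push_cast; positivity)
        push_cast
        linarith
      exact_mod_cast h3
    refine (Finset.prod_le_prod (fun _ _ => Nat.cast_nonneg _) this).trans ?_
    simp
  refine ⟨(Finset.range (⌊ℓ / r⌋₊ + 1)).biUnion Q₀, ?_, ?_⟩
  · intro u h0 hℓ hu
    have hk1 := Nat.floor_le (div_nonneg h0 hr0.le)
    have hk2 := Nat.lt_floor_add_one (height v u / r)
    set k := ⌊height v u / r⌋₊
    rw [le_div_iff₀ hr0] at hk1
    rw [div_lt_iff₀ hr0] at hk2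
    simp only [Finset.mem_biUnion, Finset.mem_range]
    refine ⟨k, Nat.lt_succ_of_le (Nat.floor_mono (by gcongr)), ?_⟩
    have h1 := norm_sub_height_smul_le hv hu
    have h2 : ‖toEuclid u - (k * r) • e‖ ≤ 3 * r := by
      have : toEuclid u - (k * r) • e =
          (toEuclid u - height v u • e) + (height v u - k * r) • e := by
        rw [sub_smul]; abel
      rw [this]
      refine (norm_add_le _ _).trans ?_
      have h3 : ‖(height v u - k * r) • e‖ ≤ r := by
        rw [norm_smul, Real.norm_eq_abs, abs_of_nonneg (by linarith)]
        refine (mul_le_of_le_one_right (by linarith) (norm_direction_le v)).trans ?_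
        linarith
      linarith
    simp only [Q₀, Fintype.mem_piFinset, Finset.mem_Icc]
    intro i
    have h3 : |(u i : ℝ) - k * r * e i| ≤ 3 * r :=
      (PiLp.norm_apply_le (toEuclid u - (k * r) • e) i).trans h2
    rw [abs_le] at h3
    exact ⟨Int.ceil_le.2 (by linarith), Int.le_floor.2 (by linarith)⟩
  · have h1 : (((Finset.range (⌊ℓ / r⌋₊ + 1)).biUnion Q₀).card : ℝ) ≤
        (⌊ℓ / r⌋₊ + 1) * (7 * r) ^ d := by
      refine (Nat.cast_le.2 Finset.card_biUnion_le).trans ?_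
      rw [Nat.cast_sum]
      refine (Finset.sum_le_card_nsmul _ _ _ fun k _ => hQ₀ k).trans ?_
      simp
    have h2 : (⌊ℓ / r⌋₊ : ℝ) + 1 ≤ 2 * (ℓ / r) := by
      have h3 := Nat.floor_le (div_nonneg (hr0.le.trans hrℓ) hr0.le)
      have h4 : 1 ≤ ℓ / r := (one_le_div hr0).2 hrℓ
      linarith
    refine h1.trans ((mul_le_mul_of_nonneg_right h2 (by positivity)).trans (le_of_eq ?_))
    obtain ⟨d, rfl⟩ := Nat.exists_eq_add_of_le' hd
    rw [Nat.add_sub_cancel, mul_pow]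
    field_simp
    ring

theorem exists_finset_touching {S : Set (Fin d → ℤ)} {Q : Finset (Fin d → ℤ)}
    (hSQ : ∀ u ∈ S, u ∈ Q) : ∃ R : Finset (Edge d), (∀ e, e ∈ R ↔ e ∈ touching S) ∧
      R.card ≤ Q.card * 3 ^ d := by
  classical
  let Q' : Finset (Sym2 (Fin d → ℤ)) := Q.biUnion fun u => (box u).image fun y => s(u, y)
  have hmaps : Set.MapsTo Subtype.val (touching S : Set (Edge d)) Q' := by
    rintro ⟨e, he⟩ ⟨u, hu, hue⟩
    obtain ⟨y, rfl⟩ := hue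
    exact Finset.mem_biUnion.2 ⟨u, hSQ u hu, Finset.mem_image.2 ⟨y, mem_box_of_adj he, rfl⟩⟩
  have hfin : (touching S : Set (Edge d)).Finite :=
    Set.Finite.of_finite_image (Q'.finite_toSet.subset hmaps.image_subset)
      Subtype.val_injective.injOn
  refine ⟨hfin.toFinset, fun e => hfin.mem_toFinset, ?_⟩
  calc hfin.toFinset.card ≤ Q'.card := Finset.card_le_card_of_injOn Subtype.val
        (fun e he => hmaps (hfin.mem_toFinset.1 he)) Subtype.val_injective.injOn
    _ ≤ Q.card * 3 ^ d := Finset.card_biUnion_le_card_mul _ _ _ fun u _ =>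
        Finset.card_image_le.trans (card_box u).le

/-- A coordinate direction which is far from being parallel to `v`. -/
theorem exists_transversal_coordinate (hd : 2 ≤ d) (v : Fin d → ℤ) :
    ∃ i, 2 * (v i : ℝ) ^ 2 ≤ ‖toEuclid v‖ ^ 2 := by
  have h : ‖toEuclid v‖ ^ 2 = ∑ i, (v i : ℝ) ^ 2 := by
    rw [EuclideanSpace.norm_sq_eq]
    simp [toEuclid]
  let i : Fin d := ⟨0, by lia⟩
  let j : Fin d := ⟨1, by lia⟩
  have hij : i ≠ j := by simp [i, j]
  have h2 : (v i : ℝ) ^ 2 + (v j : ℝ) ^ 2 ≤ ‖toEuclid v‖ ^ 2 := by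
    rw [h, ← Finset.sum_pair (f := fun i => (v i : ℝ) ^ 2) hij]
    exact Finset.sum_le_sum_of_subset_of_nonneg (Finset.subset_univ _) fun _ _ _ => sq_nonneg _
  rcases le_total ((v i : ℝ) ^ 2) ((v j : ℝ) ^ 2) with h3 | h3
  · exact ⟨i, by linarith⟩
  · exact ⟨j, by linarith⟩

theorem norm_toEuclid_single (i : Fin d) (q : ℤ) : ‖toEuclid (Pi.single i q)‖ = |(q : ℝ)| := by
  have : toEuclid (Pi.single i q) = EuclideanSpace.single i (q : ℝ) := by
    ext j
    by_cases h : j = i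
    · subst h; simp [toEuclid]
    · simp [toEuclid, h]
  rw [this, PiLp.norm_single, Real.norm_eq_abs]

theorem sq_le_of_mem_cyl_of_mem_cyl {v : Fin d → ℤ} {i : Fin d}
    (hi : 2 * (v i : ℝ) ^ 2 ≤ ‖toEuclid v‖ ^ 2) {q q' : ℤ} {u : Fin d → ℤ} {r : ℝ}
    (h : toEuclid (u + Pi.single i q) ∈ cyl (toEuclid v) r)
    (h' : toEuclid (u + Pi.single i q') ∈ cyl (toEuclid v) r) :
    ((q - q' : ℤ) : ℝ) ^ 2 ≤ 8 * r ^ 2 := by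
  obtain ⟨s, hs⟩ := h
  obtain ⟨s', hs'⟩ := h'
  have h1 : ‖toEuclid (Pi.single i (q - q')) - (s - s') • toEuclid v‖ ≤ 2 * r := by
    have : toEuclid (Pi.single i (q - q')) - (s - s') • toEuclid v =
        (toEuclid (u + Pi.single i q) - s • toEuclid v) -
        (toEuclid (u + Pi.single i q') - s' • toEuclid v) := by
      rw [Pi.single_sub, toEuclid_sub, toEuclid_add, toEuclid_add, sub_smul]
      abel
    rw [this]
    refine (norm_sub_le _ _).trans ?_
    linarith
  have h2 : ‖toEuclid (Pi.single i (q - q')) - (s - s') • toEuclid v‖ ^ 2 ≤ (2 * r) ^ 2 := by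
    gcongr
  have h3 : inner ℝ (toEuclid (Pi.single i (q - q'))) (toEuclid v) = ((q - q' : ℤ) : ℝ) * v i := by
    rw [PiLp.inner_apply, Finset.sum_eq_single i]
    · simp [toEuclid, mul_comm]
    · intro j _ hj
      simp [toEuclid, hj]
    · simp
  rw [norm_sub_sq_real, norm_toEuclid_single, inner_smul_right, h3, norm_smul, mul_pow, sq_abs,
    Real.norm_eq_abs, sq_abs] at h2
  set z : ℝ := ((q - q' : ℤ) : ℝ)
  have h4 : (s - s') ^ 2 * (2 * (v i : ℝ) ^ 2) ≤ (s - s') ^ 2 * ‖toEuclid v‖ ^ 2 := by gcongr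
  -- With `σ = s - s'` and `‖v‖² ≥ 2 v_i²`, the square is at least `z² - 2σ z v_i + 2σ² v_i² = z²/2
  -- + (2σ v_i - z)²/2`.
  nlinarith [sq_nonneg (2 * (s - s') * v i - z)]

/-! ### Expected vertex counts and the choice of a translate. -/

theorem one_sub_le_measureReal {Ω : Type*} [MeasurableSpace Ω] {μ : Measure Ω}
    [IsProbabilityMeasure μ] {f : Ω → ℝ} (hf : ∀ ω, 0 ≤ f ω) (hi : Integrable f μ) {ε p : ℝ}
    (hε : 0 < ε) (h : ∫ ω, f ω ∂μ ≤ p * ε) : 1 - p ≤ μ.real {ω | f ω ≤ ε} := by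
  have h1 := mul_meas_ge_le_integral_of_nonneg (Filter.Eventually.of_forall hf) hi ε
  have h2 : μ.real {ω | ε ≤ f ω} ≤ p := by
    refine le_of_mul_le_mul_left ?_ hε
    linarith
  have h3 : (1 : ℝ) ≤ μ.real {ω | f ω ≤ ε} + μ.real {ω | ε ≤ f ω} := by
    rw [← probReal_univ (μ := μ)]
    refine (measureReal_mono fun ω _ => ?_).trans (measureReal_union_le _ _)
    exact le_total (f ω) ε
  linarith

/-- The vertices in the slab of width `ℓ` which lie outside of the cylinder of radius `r`. -/
def outside (v : Fin d → ℤ) (ℓ r : ℝ) : Set (Fin d → ℤ) :=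
  {u | 0 ≤ height v u ∧ height v u ≤ ℓ ∧ toEuclid u ∉ cyl (toEuclid v) r}

/-- The vertices of the cylinder of radius `r` which lie in a slab of width `ℓ`, at distance at
least `s` from its boundary. -/
def inside (v : Fin d → ℤ) (s ℓ r : ℝ) : Set (Fin d → ℤ) :=
  {u | s ≤ height v u ∧ height v u ≤ ℓ - s ∧ toEuclid u ∈ cyl (toEuclid v) r}

theorem le_geodesicCount_inside {a b : ℝ} (ha : 0 < a) {t : Edge d → ℝ} (ht : IsRegular a b t)
    {v : Fin d → ℤ} {s ℓ r : ℝ} (hs : 0 ≤ s) (hℓ : ℓ ≤ ‖toEuclid v‖) :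
    ℓ - 2 * s - 1 ≤ geodesicCount (inside v s ℓ r) 0 v t + geodesicCount (outside v ℓ r) 0 v t := by
  obtain ⟨p, hp, -⟩ := ht.exists_isUniqueGeodesic ha 0 v
  have h1 := le_ncard_slab p (height_le_of_adj v) (z := s) (z' := ℓ - s) (by simpa using hs)
    (by rw [height_self]; linarith)
  have h2 : ({u | u ∈ p.support} ∩ {u | s ≤ height v u ∧ height v u ≤ ℓ - s}).ncard ≤
      geodesicCount (inside v s ℓ r) 0 v t + geodesicCount (outside v ℓ r) 0 v t := by
    rw [geodesicCount, geodesicCount, hp.geodesicVertices_eq]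
    refine le_trans ?_ (Set.ncard_union_le _ _)
    refine Set.ncard_le_ncard ?_ (((List.finite_toSet _).subset Set.inter_subset_left).union
      ((List.finite_toSet _).subset Set.inter_subset_left))
    rintro u ⟨hu, hu1, hu2⟩
    by_cases hc : toEuclid u ∈ cyl (toEuclid v) r
    · exact Or.inl ⟨hu, hu1, hu2, hc⟩
    · exact Or.inr ⟨hu, by linarith, by linarith, hc⟩
  have h3 : (({u | u ∈ p.support} ∩ {u | s ≤ height v u ∧ height v u ≤ ℓ - s}).ncard : ℝ) ≤
      geodesicCount (inside v s ℓ r) 0 v t + geodesicCount (outside v ℓ r) 0 v t := by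
    exact_mod_cast h2
  linarith

theorem sum_geodesicCount_le {J : Type*} (I : Finset J) {S : J → Set (Fin d → ℤ)}
    {S' : Set (Fin d → ℤ)} (hS : ∀ j ∈ I, S j ⊆ S')
    (hdisj : ∀ u, ∀ i ∈ I, ∀ j ∈ I, u ∈ S i → u ∈ S j → i = j) (x y : Fin d → ℤ)
    (t : Edge d → ℝ) : ∑ j ∈ I, geodesicCount (S j) x y t ≤ geodesicCount S' x y t := by
  classical
  have hcount : ∀ Q : Set (Fin d → ℤ), geodesicCount Q x y t =
      ((finite_geodesicVertices t x y).toFinset.filter (· ∈ Q)).card := by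
    intro Q
    rw [geodesicCount, ← Set.ncard_coe_finset]
    congr 1
    ext u
    simp
  simp only [hcount]
  rw [← Finset.card_biUnion]
  · refine Finset.card_le_card fun u hu => ?_
    simp only [Finset.mem_biUnion, Finset.mem_filter] at hu ⊢
    obtain ⟨j, hj, hu, huj⟩ := hu
    exact ⟨hu, hS j hj huj⟩
  · intro i hi j hj hij
    rw [Function.onFun, Finset.disjoint_left]
    intro u hu hu'
    exact hij (hdisj u i hi j hj (Finset.mem_filter.1 hu).2 (Finset.mem_filter.1 hu').2)

theorem one_add_pow_sub_one_le {x : ℝ} (hx : 0 ≤ x) (n : ℕ) (h : n * x ≤ 1) :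
    (1 + x) ^ n - 1 ≤ 2 * (n * x) := by
  have h1 : (1 + x) ^ n ≤ Real.exp (n * x) := by
    rw [Real.exp_nat_mul]
    gcongr
    linarith [Real.add_one_le_exp x]
  have h0 : 0 ≤ n * x := by positivity
  have h2 := Real.abs_exp_sub_one_le (x := n * x) (by rwa [abs_of_nonneg h0])
  rw [abs_of_nonneg h0] at h2
  linarith [le_abs_self (Real.exp (n * x) - 1)]

/-- If few vertices are expected outside of the cylinder, then some translate of the cylinder
contains an even smaller number of vertices. -/
theorem exists_translate_integral_le {G : Measure ℝ} [IsProbabilityMeasure G] {a b α : ℝ}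
    (hG : WeightBounds G a b α) (hd : 2 ≤ d) (v : Fin d → ℤ) {ℓ r : ℝ} (hr : 1 ≤ r) {m : ℕ}
    (hm : 0 < m) {D : ℝ}
    (hout : ∫ t, (geodesicCount (outside v ℓ r) 0 v t : ℝ) ∂(iidLaw (Edge d) G) ≤ D) :
    ∃ w : Fin d → ℤ, ∑ i, |(w i : ℝ)| ≤ 4 * m * r ∧
      ∫ t, (geodesicCount (inside v (4 * m * r) ℓ r) w (v + w) t : ℝ) ∂(iidLaw (Edge d) G) ≤
        D / m := by
  obtain ⟨i, hi⟩ := exists_transversal_coordinate hd v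
  have hk1 := Nat.le_ceil (3 * r)
  have hk2 := Nat.ceil_lt_add_one (a := 3 * r) (by linarith)
  -- Spacing at least `3r > √8 r` makes the shifted cylinders disjoint; `k ≤ 4r`, as `r ≥ 1`, keeps
  -- all `m` shifts below the margin `4 m r`, so the shifted pieces stay in the slab.
  set k := ⌈3 * r⌉₊
  let w : ℕ → Fin d → ℤ := fun j => Pi.single i ((j * k : ℕ) : ℤ)
  let S : ℕ → Set (Fin d → ℤ) := fun j => translation (w j) ⁻¹' inside v (4 * m * r) ℓ r
  have hwle : ∀ j ∈ Finset.Icc 1 m, ((j * k : ℕ) : ℝ) ≤ 4 * m * r := by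
    intro j hj
    have h1 : (j : ℝ) ≤ m := by exact_mod_cast (Finset.mem_Icc.1 hj).2
    push_cast
    calc (j : ℝ) * k ≤ m * (4 * r) := by gcongr; linarith
      _ = 4 * m * r := by ring
  have hsep : ∀ (u : Fin d → ℤ) (j j' : ℕ), toEuclid (u + w j) ∈ cyl (toEuclid v) r →
      toEuclid (u + w j') ∈ cyl (toEuclid v) r → j = j' := by
    intro u j j' h h'
    have h1 := sq_le_of_mem_cyl_of_mem_cyl hi h h'
    by_contra hne
    have h2 : (1 : ℝ) ≤ ((j : ℝ) - j') ^ 2 := by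
      have : (1 : ℤ) ≤ ((j : ℤ) - j') ^ 2 := by
        have : ((j : ℤ) - j') ≠ 0 := sub_ne_zero.2 (by exact_mod_cast hne)
        have := Int.one_le_abs this
        rw [← sq_abs]
        nlinarith
      exact_mod_cast this
    push_cast at h1
    have h3 : ((j : ℝ) * k - j' * k) ^ 2 = (j - j') ^ 2 * k ^ 2 := by ring
    rw [h3] at h1
    have h4 : (3 * r) ^ 2 ≤ (k : ℝ) ^ 2 := by gcongr
    nlinarith
  have hsub : ∀ j ∈ Finset.Icc 1 m, S j ⊆ outside v ℓ r := by
    intro j hj u hu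
    obtain ⟨hu1, hu2, hu3⟩ := hu
    rw [translation_apply] at hu1 hu2 hu3
    rw [height_add] at hu1 hu2
    have h1 := abs_height_le v (w j)
    rw [norm_toEuclid_single] at h1
    have h2 := hwle j hj
    have h3 : |(((j * k : ℕ) : ℤ) : ℝ)| = ((j * k : ℕ) : ℝ) := by
      rw [Int.cast_natCast, abs_of_nonneg (Nat.cast_nonneg _)]
    rw [h3] at h1
    have h4 := abs_le.1 (h1.trans h2)
    refine ⟨by linarith [h4.2], by linarith [h4.1], fun hcyl => ?_⟩
    -- The unshifted cylinder is the case `j = 0`, so disjointness also places the translates with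
    -- `j ≥ 1` outside it.
    have h5 := hsep u j 0 hu3 (by simpa [w] using hcyl)
    have h6 := (Finset.mem_Icc.1 hj).1
    lia
  have hsum : ∑ j ∈ Finset.Icc 1 m,
      ∫ t, (geodesicCount (S j) 0 v t : ℝ) ∂(iidLaw (Edge d) G) ≤
      ∑ _j ∈ Finset.Icc 1 m, D / m := by
    rw [← integral_finsetSum _ fun j _ => integrable_geodesicCount hG _ _ _]
    have h1 : ∑ _j ∈ Finset.Icc 1 m, D / (m : ℝ) = D := by
      rw [Finset.sum_const, Nat.card_Icc, nsmul_eq_mul, Nat.add_sub_cancel]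
      field_simp
    rw [h1]
    refine le_trans (integral_mono (integrable_finsetSum _ fun j _ =>
      integrable_geodesicCount hG _ _ _) (integrable_geodesicCount hG _ _ _) fun t => ?_) hout
    have := sum_geodesicCount_le (Finset.Icc 1 m) hsub
      (fun u i _ j _ h h' => hsep u i j h.2.2 h'.2.2) 0 v t
    exact_mod_cast this
  obtain ⟨j, hj, hle⟩ := Finset.exists_le_of_sum_le (Finset.nonempty_Icc.2 hm) hsum
  refine ⟨w j, ?_, ?_⟩
  · rw [Finset.sum_eq_single i]
    · refine le_trans (le_of_eq ?_) (hwle j hj)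
      simp only [w, Pi.single_eq_same]
      rw [Int.cast_natCast, abs_of_nonneg (Nat.cast_nonneg _)]
    · intro i' _ hi'
      simp [w, hi']
    · simp
  · have h1 := integral_geodesicCount_map (G := G) (translation (w j))
      (inside v (4 * m * r) ℓ r) 0 v
    simp only [translation_apply, zero_add] at h1
    rw [h1]
    exact hle

theorem key_inequality {G : Measure ℝ} [IsProbabilityMeasure G] {a b α : ℝ}
    (hG : WeightBounds G a b α) (hd : 2 ≤ d) {κ : ℝ} (hκ : 0 ≤ κ) {A : Set ℝ}
    (hA : MeasurableSet A) (hAr : A ⊆ robustWeights G a b κ) {v : Fin d → ℤ} {ℓ r : ℝ}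
    (hr : 1 ≤ r) (hrℓ : r ≤ ℓ) (hℓ : ℓ ≤ ‖toEuclid v‖) {m : ℕ} (hm : 0 < m) {K k : ℕ}
    (hK : b * (d * (3 * ℓ)) < a * K)
    (hB : (4 * 3 ^ d) ^ K * G Aᶜ ^ k ≤ ENNReal.ofReal (1 / 20)) {τ : ℝ} (h0 : 0 ≤ τ)
    (h1 : τ < 1) (hτ : 2 * 21 ^ d * (ℓ * r ^ (d - 1)) * τ ^ 2 ≤ 1 / 800) {η : ℝ} (hη : 0 < η)
    (hηm : 5 ≤ η * m)
    (hout : ∫ t, (geodesicCount (outside v ℓ r) 0 v t : ℝ) ∂(iidLaw (Edge d) G) ≤ ℓ / 2) :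
    κ * τ * (ℓ / 4 - 2 * (4 * m * r) - 1 - k) ≤
      τ / α * (2 * (η * ℓ)) + 4 * b * (4 * m * r) := by
  have hℓ0 : 0 < ℓ := by linarith
  have hv : 0 < ‖toEuclid v‖ := by linarith
  have hb : 0 < b := hG.a_pos.trans hG.a_lt_b
  set s := 4 * m * r with hs
  have hs0 : 0 ≤ s := by positivity
  have hm0 : (0 : ℝ) < m := by exact_mod_cast hm
  obtain ⟨w, hw, hwint⟩ := exists_translate_integral_le hG hd v hr hm hout
  obtain ⟨Q, hQ, hQcard⟩ := exists_finset_cyl hv (by lia) hr hrℓ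
  obtain ⟨R, hR, hRcard⟩ := exists_finset_touching (S := inside v s ℓ r) (Q := Q)
    fun u hu => hQ u (by linarith [hu.1]) (by linarith [hu.2.1]) hu.2.2
  have hRτ : R.card * τ ^ 2 ≤ 1 / 800 := by
    refine le_trans ?_ hτ
    gcongr
    calc (R.card : ℝ) ≤ Q.card * 3 ^ d := by exact_mod_cast hRcard
      _ ≤ 2 * 7 ^ d * (ℓ * r ^ (d - 1)) * 3 ^ d := by gcongr
      _ = 2 * 21 ^ d * (ℓ * r ^ (d - 1)) := by
        rw [show (21 : ℝ) = 7 * 3 by norm_num, mul_pow]; ring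
  have hpow := one_add_pow_sub_one_le (sq_nonneg τ) R.card (by linarith)
  have hS : ∀ u ∈ inside v s ℓ r, b * ∑ i, |(u i : ℝ)| < a * K := by
    intro u hu
    refine lt_of_le_of_lt ?_ hK
    gcongr
    refine (sum_abs_le u).trans ?_
    gcongr
    have h2 := norm_toEuclid_le hv hu.2.2
    rw [abs_of_nonneg (hs0.trans hu.1)] at h2
    linarith [hu.2.1]
  -- Markov at level `3ℓ/4`: an expectation of at most `ℓ/2` leaves probability at least `1/3`, and
  -- on that event at least `ℓ - 2s - 1 - 3ℓ/4` vertices lie inside.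
  have hN : 1 / 3 ≤ (iidLaw (Edge d) G).real
      {t | ℓ / 4 - 2 * s - 1 ≤ geodesicCount (inside v s ℓ r) 0 v t} := by
    have h2 := one_sub_le_measureReal (ε := 3 * ℓ / 4) (p := 2 / 3) (fun t => Nat.cast_nonneg _)
      (integrable_geodesicCount hG (outside v ℓ r) 0 v) (by positivity) (by linarith)
    have h3 : (iidLaw (Edge d) G) {t | (geodesicCount (outside v ℓ r) 0 v t : ℝ) ≤ 3 * ℓ / 4} ≤
        (iidLaw (Edge d) G) {t | ℓ / 4 - 2 * s - 1 ≤ geodesicCount (inside v s ℓ r) 0 v t} := by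
      refine measure_mono_ae ?_
      filter_upwards [ae_isRegular hG] with t ht hout
      have h4 := le_geodesicCount_inside hG.a_pos ht (r := r) hs0 hℓ
      have h5 : (geodesicCount (outside v ℓ r) 0 v t : ℝ) ≤ 3 * ℓ / 4 := hout
      change ℓ / 4 - 2 * s - 1 ≤ (geodesicCount (inside v s ℓ r) 0 v t : ℝ)
      linarith
    have h4 := ENNReal.toReal_mono (measure_ne_top _ _) h3
    rw [measureReal_def] at h2 ⊢
    linarith
  -- Markov again: `ℓ/(2m) ≤ ηℓ/10` because `η m ≥ 5`.
  have hN' : 9 / 10 ≤ (iidLaw (Edge d) G).real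
      {t | geodesicCount (inside v s ℓ r) w (v + w) t ≤ η * ℓ} := by
    have h2 := one_sub_le_measureReal (ε := η * ℓ) (p := 1 / 10) (fun t => Nat.cast_nonneg _)
      (integrable_geodesicCount hG (inside v s ℓ r) w (v + w)) (by positivity) (by
        refine hwint.trans ?_
        rw [div_le_iff₀ hm0]
        nlinarith)
    linarith
  have h2 := perturbation_bound hG hκ hA hAr v w hR hS hB h0 h1 (by linarith) hN hN'
  have h3 : 4 * b * ∑ i, |(w i : ℝ)| ≤ 4 * b * s := by gcongr
  linarith


/-! ### Choice of constants and conclusion. -/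

theorem pow_mul_pow_le {D p : ENNReal} {M K k : ℕ} (hD : 1 ≤ D) (hDp : D ^ M * p ≤ 2⁻¹)
    (hK : K ≤ M * k) (hk : 5 ≤ k) : D ^ K * p ^ k ≤ ENNReal.ofReal (1 / 20) := by
  calc D ^ K * p ^ k ≤ D ^ (M * k) * p ^ k := by gcongr
    _ = (D ^ M * p) ^ k := by rw [mul_pow, pow_mul]
    _ ≤ 2⁻¹ ^ k := by gcongr
    _ ≤ 2⁻¹ ^ 5 := by
        refine pow_le_pow_right_of_le_one' ?_ hk
        simp
    _ = ENNReal.ofReal ((1 / 2) ^ 5) := by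
        rw [ENNReal.ofReal_pow (by norm_num), one_div, ENNReal.ofReal_inv_of_pos two_pos]
        norm_num
    _ ≤ ENNReal.ofReal (1 / 20) := ENNReal.ofReal_le_ofReal (by norm_num)

/-- The lower bound for the expected number of vertices outside of a cylinder, in terms of the
law of the weights. -/
theorem exists_half_le_integral_outside {G : Measure ℝ} [IsProbabilityMeasure G] {a b α : ℝ}
    (hG : WeightBounds G a b α) (hd : 2 ≤ d) : ∃ c ℓ₀ : ℝ, 0 < c ∧ ∀ (v : Fin d → ℤ) (ℓ : ℝ),
      ℓ₀ ≤ ℓ → ℓ ≤ ‖toEuclid v‖ → ℓ / 2 ≤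
        ∫ t, (geodesicCount (outside v ℓ (c * ℓ ^ (1 / ((d : ℝ) + 1)))) 0 v t : ℝ)
          ∂(iidLaw (Edge d) G) := by
  have ha := hG.a_pos
  have hb : 0 < b := ha.trans hG.a_lt_b
  have hα := hG.α_pos
  let C₁ : ℝ := b * (d * 3) / a
  have hC₁ : 0 < C₁ := by positivity
  -- The path length `K ≈ C₁ ℓ` is at most `M k` for the tolerance `k ≈ ℓ/100` of exceptional edges;
  -- `G Aᶜ` is then chosen so small that `D ^ M * G Aᶜ ≤ 1/2` beats the entropy.
  let M : ℕ := ⌈100 * (C₁ + 1)⌉₊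
  let D : ENNReal := 4 * 3 ^ d
  have hD1 : 1 ≤ D := by
    have : (1 : ENNReal) ≤ (4 * 3 ^ d : ℕ) := by exact_mod_cast Nat.pos_of_ne_zero (by positivity)
    simpa [D] using this
  have hDtop : D ^ M ≠ ⊤ := by
    refine ENNReal.pow_ne_top ?_
    have : D = (4 * 3 ^ d : ℕ) := by simp [D]
    rw [this]
    exact ENNReal.natCast_ne_top _
  have hD0 : D ^ M ≠ 0 := pow_ne_zero _ (one_pos.trans_le hD1).ne'
  obtain ⟨κ, hκ, A, hA, hAr, hAp⟩ := hG.exists_robustWeights (p := 2⁻¹ * (D ^ M)⁻¹)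
    (ENNReal.mul_pos (by simp) (by simpa using hDtop))
  have hDp : D ^ M * G Aᶜ ≤ 2⁻¹ := by
    calc D ^ M * G Aᶜ ≤ D ^ M * (2⁻¹ * (D ^ M)⁻¹) := by gcongr
      _ = 2⁻¹ * (D ^ M * (D ^ M)⁻¹) := by ring
      _ = 2⁻¹ := by rw [ENNReal.mul_inv_cancel hD0 hDtop, mul_one]
  -- Makes the loss `(τ/α)(2ηℓ)` equal to `κτℓ/16`, half of the guaranteed gain `κτℓ/8`.
  let η : ℝ := α * κ / 32
  have hη : 0 < η := by positivity
  obtain ⟨m, hm5⟩ := exists_nat_ge (5 / η)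
  rw [div_le_iff₀ hη, mul_comm] at hm5
  have hm : 0 < m := by
    rcases Nat.eq_zero_or_pos m with rfl | h
    · norm_num at hm5
    · exact h
  have hm1 : (1 : ℝ) ≤ m := by exact_mod_cast hm
  let C₂ : ℝ := 2 * 21 ^ d
  have hC₂ : 1 ≤ C₂ := by
    have : (1 : ℝ) ≤ 21 ^ d := one_le_pow₀ (by norm_num)
    change 1 ≤ 2 * (21 : ℝ) ^ d
    linarith
  let C₃ : ℝ := 800 * C₂ * (256 * b * m / κ) ^ 2
  have hC₃ : 0 ≤ C₃ := by positivity
  let c : ℝ := 1 / (1 + 2 * C₃)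
  have hc : 0 < c := by positivity
  have hc1 : c ≤ 1 := (div_le_one (by positivity)).2 (by linarith)
  have hcC : C₃ * c ≤ 1 / 2 := by
    rw [mul_one_div, div_le_div_iff₀ (by positivity) two_pos]
    linarith
  -- The three thresholds give `k ≥ 5` together with control of the additive constants, `400 m r ≤
  -- ℓ`, and `r ≥ 1`.
  refine ⟨c, max (max 500 ((400 * m) ^ 2)) (1 / c ^ (d + 1)), hc, fun v ℓ hℓ₀ hℓ => ?_⟩
  have hℓ1 : 500 ≤ ℓ := (le_max_left _ _).trans ((le_max_left _ _).trans hℓ₀)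
  have hℓ2 : (400 * m : ℝ) ^ 2 ≤ ℓ := (le_max_right _ _).trans ((le_max_left _ _).trans hℓ₀)
  have hℓ3 : 1 / c ^ (d + 1) ≤ ℓ := (le_max_right _ _).trans hℓ₀
  have hℓ0 : 0 < ℓ := by linarith
  rw [div_le_iff₀' (by positivity)] at hℓ3
  set r := c * ℓ ^ (1 / ((d : ℝ) + 1)) with hr
  have hr0 : 0 < r := by positivity
  have hrpow : r ^ (d + 1) = c ^ (d + 1) * ℓ := by
    rw [hr, mul_pow, ← Real.rpow_natCast (ℓ ^ _), ← Real.rpow_mul hℓ0.le]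
    push_cast
    rw [one_div_mul_cancel (by positivity), Real.rpow_one]
  have hr1 : 1 ≤ r := by
    by_contra! h
    have := pow_lt_one₀ hr0.le h (Nat.succ_ne_zero d)
    rw [Nat.succ_eq_add_one, hrpow] at this
    linarith
  have hrm : 400 * m * r ≤ ℓ := by
    set y := ℓ / (400 * m) with hy
    have hy1 : 400 * m ≤ y := by
      rw [hy, le_div_iff₀ (by positivity), ← sq]
      exact hℓ2
    have hyℓ : ℓ = 400 * m * y := by rw [hy]; field_simp
    have h1 : r ^ (d + 1) ≤ y ^ (d + 1) := by
      calc r ^ (d + 1) = c ^ (d + 1) * ℓ := hrpow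
        _ ≤ 1 * ℓ := by gcongr; exact pow_le_one₀ hc.le hc1
        _ = 400 * m * y := by rw [one_mul]; exact hyℓ
        _ ≤ y * y := by gcongr
        _ = y ^ 2 := by ring
        _ ≤ y ^ (d + 1) := pow_le_pow_right₀ (by linarith) (by lia)
    have h2 : r ≤ y := le_of_pow_le_pow_left₀ (Nat.succ_ne_zero d) (by positivity) h1
    rw [hyℓ]
    gcongr
  have hrℓ : r ≤ ℓ := by nlinarith
  by_contra! hlt
  let K : ℕ := ⌊C₁ * ℓ⌋₊ + 1
  let k : ℕ := ⌈ℓ / 100⌉₊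
  have hk1 : ℓ / 100 ≤ k := Nat.le_ceil _
  have hk2 : (k : ℝ) < ℓ / 100 + 1 := Nat.ceil_lt_add_one (by positivity)
  have hk5 : 5 ≤ (k : ℝ) := by linarith
  have hK1 : C₁ * ℓ < K := by
    have := Nat.lt_floor_add_one (C₁ * ℓ)
    push_cast [K]
    exact this
  have hK2 : (K : ℝ) ≤ C₁ * ℓ + 1 := by
    have := Nat.floor_le (a := C₁ * ℓ) (by positivity)
    push_cast [K]
    linarith
  have hKk : K ≤ M * k := by
    have hM : 100 * (C₁ + 1) ≤ M := Nat.le_ceil _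
    have : (K : ℝ) ≤ M * k := by
      calc (K : ℝ) ≤ 100 * (C₁ + 1) * (ℓ / 100) := by linarith
        _ ≤ M * k := by gcongr
    exact_mod_cast this
  have haK : b * (d * (3 * ℓ)) < a * K := by
    have : a * (C₁ * ℓ) < a * K := by gcongr
    refine lt_of_eq_of_lt ?_ this
    simp only [C₁]
    field_simp
  let X : ℝ := ℓ * r ^ (d - 1)
  have hX1 : 1 ≤ X := one_le_mul_of_one_le_of_one_le (by linarith) (one_le_pow₀ hr1)
  -- As large as the total variation bound allows: `|R| τ² ≤ 1/800`, hence `(1 + τ²)^|R| - 1 ≤ 1/400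
  -- = (1/20)²`.
  let τ : ℝ := Real.sqrt (1 / (800 * C₂ * X))
  have hCX : 1 ≤ C₂ * X := one_le_mul_of_one_le_of_one_le hC₂ hX1
  have hτ2 : τ ^ 2 = 1 / (800 * C₂ * X) := Real.sq_sqrt (by positivity)
  have hτ0 : 0 < τ := Real.sqrt_pos.2 (by positivity)
  have hτ1 : τ < 1 := by
    have : τ ^ 2 < 1 := by
      rw [hτ2, div_lt_one (by positivity)]
      nlinarith
    nlinarith
  have hkey := key_inequality hG hd hκ.le hA hAr hr1 hrℓ hℓ hm haK
    (pow_mul_pow_le hD1 hDp hKk (by exact_mod_cast hk5)) hτ0.le hτ1 (le_of_eq (by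
      rw [hτ2]
      change C₂ * X * _ = _
      field_simp)) hη hm5 hlt.le
  have h1 : ℓ / 8 ≤ ℓ / 4 - 2 * (4 * m * r) - 1 - k := by linarith
  have h2 : τ / α * (2 * (η * ℓ)) = κ * τ * (ℓ / 16) := by
    simp only [η]
    field_simp
    ring
  rw [h2] at hkey
  have h3 := mul_le_mul_of_nonneg_left h1 (mul_pos hκ hτ0).le
  -- From `κτℓ/8 ≤ κτℓ/16 + 16 b m r`. Squaring and inserting `τ²` gives `ℓ ≤ C₃ r^(d+1) = C₃
  -- c^(d+1) ℓ ≤ ℓ/2`, a contradiction.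
  have h4 : τ * ℓ ≤ 256 * b * m / κ * r := by
    rw [div_mul_eq_mul_div, le_div_iff₀ hκ]
    linarith
  have h5 : (τ * ℓ) ^ 2 ≤ (256 * b * m / κ * r) ^ 2 := by gcongr
  have h6 : ℓ ≤ C₃ * r ^ (d + 1) := by
    rw [mul_pow, hτ2, div_mul_eq_mul_div, one_mul, div_le_iff₀ (by positivity)] at h5
    have h7 : (256 * b * m / κ * r) ^ 2 * (800 * C₂ * X) = C₃ * r ^ (d + 1) * ℓ := by
      obtain ⟨d, rfl⟩ := Nat.exists_eq_add_of_le' (show 1 ≤ d by lia)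
      simp only [C₃, X, Nat.add_sub_cancel]
      ring
    rw [h7, sq] at h5
    exact le_of_mul_le_mul_right h5 hℓ0
  have h7 : c ^ (d + 1) ≤ c := pow_le_of_le_one hc.le hc1 (Nat.succ_ne_zero d)
  rw [hrpow] at h6
  have h8 : C₃ * (c ^ (d + 1) * ℓ) ≤ 1 / 2 * ℓ := by
    rw [← mul_assoc]
    gcongr
    exact (mul_le_mul_of_nonneg_left h7 hC₃).trans hcC
  linarith

theorem hasLaw_iidLaw {G : Measure ℝ} [IsProbabilityMeasure G] {Ω : Type*} [MeasurableSpace Ω]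
    {P : Measure Ω} {t : Edge d → Ω → ℝ} (ht : ∀ e, HasLaw (t e) G P)
    (hind : iIndepFun t P) : HasLaw (fun ω e => t e ω) (iidLaw (Edge d) G) P :=
  hind.hasLaw_infinitePi ht (aemeasurable_pi_iff.2 fun e => (ht e).aemeasurable)

end FPP

theorem theorem1p4 (d : ℕ) (hd : 2 ≤ d) (G : Measure ℝ) [IsProbabilityMeasure G]
    (hG : FPP.WeightAssumption G) :
    ∃ c n₀ : ℝ, 0 < c ∧ 1 ≤ n₀ ∧
      ∀ (Ω : Type*) [MeasurableSpace Ω] (P : Measure Ω) [IsProbabilityMeasure P]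
        (t : FPP.Edge d → Ω → ℝ),
        (∀ e, HasLaw (t e) G P) → iIndepFun t P →
        ∀ v : Fin d → ℤ, n₀ ≤ ‖FPP.toEuclid v‖ →
          (∀ ℓ : ℝ, Real.log ‖FPP.toEuclid v‖ ^ (d + 2) ≤ ℓ → ℓ ≤ ‖FPP.toEuclid v‖ →
            ℓ / 2 ≤ ∫ ω, (({u ∈ FPP.geodesicVertices (fun e => t e ω) 0 v |
                  0 ≤ inner ℝ (FPP.toEuclid u) (‖FPP.toEuclid v‖⁻¹ • FPP.toEuclid v) ∧
                  inner ℝ (FPP.toEuclid u) (‖FPP.toEuclid v‖⁻¹ • FPP.toEuclid v) ≤ ℓ ∧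
                  FPP.toEuclid u ∉
                    FPP.cyl (FPP.toEuclid v) (c * ℓ ^ (1 / ((d : ℝ) + 1)))}.ncard : ℕ) : ℝ) ∂P) ∧
          ‖FPP.toEuclid v‖ / 2 ≤ ∫ ω, (({u ∈ FPP.geodesicVertices (fun e => t e ω) 0 v |
                  FPP.toEuclid u ∉ FPP.cyl (FPP.toEuclid v)
                    (c * ‖FPP.toEuclid v‖ ^ (1 / ((d : ℝ) + 1)))}.ncard : ℕ) : ℝ) ∂P := by
  obtain ⟨a, b, α, hG⟩ := hG.exists_weightBounds
  obtain ⟨c, ℓ₀, hc, hmain⟩ := FPP.exists_half_le_integral_outside hG hd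
  -- The logarithmic lower bound on `ℓ` serves only to guarantee `ℓ ≥ ℓ₀` once `‖v‖` is large.
  have hlog : ∀ᶠ x : ℝ in Filter.atTop, ℓ₀ ≤ Real.log x ^ (d + 2) :=
    ((Filter.tendsto_pow_atTop (by lia)).comp Real.tendsto_log_atTop).eventually_ge_atTop ℓ₀
  obtain ⟨n₁, hn₁⟩ := Filter.eventually_atTop.1 hlog
  refine ⟨c, max 1 (max n₁ ℓ₀), hc, le_max_left _ _, ?_⟩
  intro Ω _ P _ t ht hind v hv
  have hlaw := FPP.hasLaw_iidLaw ht hind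
  have hv₁ : n₁ ≤ ‖FPP.toEuclid v‖ := (le_max_left _ _).trans ((le_max_right _ _).trans hv)
  have hv₂ : ℓ₀ ≤ ‖FPP.toEuclid v‖ := (le_max_right _ _).trans ((le_max_right _ _).trans hv)
  have hint : ∀ S : Set (Fin d → ℤ),
      ∫ ω, (FPP.geodesicCount S 0 v (fun e => t e ω) : ℝ) ∂P =
        ∫ t, (FPP.geodesicCount S 0 v t : ℝ) ∂(FPP.iidLaw (FPP.Edge d) G) := by
    intro S
    rw [← hlaw.map_eq, integral_map hlaw.aemeasurable]
    exact (measurable_from_top.comp (FPP.measurable_geodesicCount S 0 v)).aestronglyMeasurable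
  constructor
  · intro ℓ hℓ hℓv
    refine (hmain v ℓ ((hn₁ _ hv₁).trans hℓ) hℓv).trans (le_of_eq ?_)
    rw [← hint]
    rfl
  · refine (hmain v _ hv₂ le_rfl).trans ?_
    refine (integral_mono (FPP.integrable_geodesicCount hG _ 0 v) (FPP.integrable_geodesicCount hG
      {u | FPP.toEuclid u ∉ FPP.cyl (FPP.toEuclid v) (c * ‖FPP.toEuclid v‖ ^ (1 / ((d : ℝ) + 1)))} 0 v)
      fun t => ?_).trans (le_of_eq ?_)
    · refine Nat.cast_le.2 (Set.ncard_le_ncard ?_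
        ((FPP.finite_geodesicVertices t 0 v).subset Set.inter_subset_left))
      exact Set.inter_subset_inter_right _ fun u hu => hu.2.2
    · rw [← hint]
      rfl
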